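/- Let $t_1,t_2$ be bounded operators on a complex Hilbert space $\mathcal H$ with $t_i^*t_j=\delta_{ij}I$ and $t_1t_1^*+t_2t_2^*=I$ (a representation of the Cuntz algebra $\mathcal O_2$), and let $\Omega\in\mathcal H$ be a cyclic unit vector with $t_1\Omega=\Omega$. Let $\mathcal D$ be the linear span of the vectors $t_{i_1}\cdots t_{i_r}\Omega$ ($r\ge 1$), and put $s_m=t_2^{m-1}t_1$ ($m\ge1$). The recursive boson system on $\mathcal D$ is $$b_1=\sum_{m\ge1}\sqrt m\,s_ms_{m+1}^*,\qquad b_n=\sum_{m\ge1}s_mb_{n-1}s_m^*\quad(n\ge2),$$ with adjoints $b_1^*=\sum_{m\ge 1}\sqrt m\,s_{m+1}s_m^*$, $b_n^*=\sum_{m\ge1}s_mb_{n-1}^*s_m^*$ (all sums converging at each vector of $\mathcal D$), and the recursive fermion system on $\mathcal H$ is $$a_1=t_1t_2^*,\qquad a_n=t_1a_{n-1}t_1^*-t_2a_{n-1}t_2^*\quad(n\ge2).$$ Let $\mathcal H_B$ carry the Fock representation of bosons: operators $b_n,b_n^*$ ($n\ge1$), formally adjoint to each other, on a dense invariant domain $\mathcal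 D_B$, with $[b_n,b_m^*]=\delta_{nm}I$, $[b_n,b_m]=[b_n^*,b_m^*]=0$, and a unit vacuum vector $\Omega_B\in\mathcal D_B$ with $b_n\Omega_B=0$ for all $n$, from which the algebra generated by the $b_n,b_n^*$ generates $\mathcal D_B$. Let $\mathcal H_F$ carry the Fock representation of fermions: bounded operators $a_n$ ($n\ge1$) with $\{a_n,a_m^*\}=\delta_{nm}I$, $\{a_n,a_m\}=0$, and a cyclic unit vacuum vector $\Omega_F$ with $a_n\Omega_F=0$ for all $n$. Then there are a unique unitary $V_B:\mathcal H\to\mathcal H_B$ with $V_B\Omega=\Omega_B$ and $V_B\mathcal D=\mathcal D_B$ that carries the recursive boson system and its adjoints to the operators $b_n,b_n^*$ on $\mathcal D_B$, and a unique unitary $V_F:\mathcal H\to\mathcal H_F$ with $V_F\Omega=\Omega_F$ that carries the recursive fermion system to the operators $a_n$ on $\mathcal H_F$. Put $U=V_FV_B^*:\mathcal H_B\to\mathcal H_F$, and $$A_{n,k}=a_{n+1}^*a_{n+2}^*\cdots a_{n+k}^*\qquad(n\ge0,\ k\ge1).$$ There is a bijection $\Phi$ from the set of boson creation monomials $(b_{n_1}^*)^{k_1}\cdots(b_{n_m}^*)^{k_m}$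 ($m\ge0$, $1\le n_1<\cdots<n_m$, all $k_i\ge1$), as operators on $\mathcal D_B$, onto the set of fermion creation monomials $a_{j_1}^*\cdots a_{j_l}^*$ ($l\ge0$, $1\le j_1<\cdots<j_l$), as operators on $\mathcal H_F$, given by $$\Phi\bigl((b_{n_1}^*)^{k_1}\cdots(b_{n_m}^*)^{k_m}\bigr)=A_{n_1-1,k_1}A_{n_2+k_1-1,k_2}\cdots A_{n_m+k_1+\cdots+k_{m-1}-1,k_m},$$ and it is implemented by $U$ up to the vacua and a normalization constant: $U\Omega_B=\Omega_F$ and, for every boson creation monomial $X=(b_{n_1}^*)^{k_1}\cdots(b_{n_m}^*)^{k_m}$ as above, $$U\,X\,\Omega_B=\sqrt{k_1!\cdots k_m!}\;\Phi(X)\,\Omega_F .$$ -/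

import Mathlib

/-! Modes are numbered from `0`: the index `n : ℕ` stands for the mode `n + 1`, so that
the `n`-th operator of a boson or fermion system is $b_{n+1}$ or $a_{n+1}$, and `s n` is $s_{n+1}$. Likewise `t 0`, `t 1`
are $t_1$, $t_2$. -/

/-- A Hilbert space representation of the Cuntz algebra $O_2$ (equivalently, by universality,
two bounded operators satisfying the Cuntz relations) with a cyclic unit vector `Ω` such that
$t_1 Ω = Ω$. -/
structure CuntzVacuumRep (H : Type*) [NormedAddCommGroup H] [InnerProductSpace ℂ H]
    [CompleteSpace H] where
  t : Fin 2 → (H →L[ℂ] H)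
  star_mul : ∀ i j, star (t i) * t j = if i = j then 1 else 0
  sum_mul_star : t 0 * star (t 0) + t 1 * star (t 1) = 1
  Ω : H
  norm_Ω : ‖Ω‖ = 1
  t_Ω : t 0 Ω = Ω
  cyclic : Dense {v : H | ∃ X ∈ StarAlgebra.adjoin ℂ (Set.range t), X Ω = v}

/-- The Fock representation of bosons on the Hilbert space `H`: operators $b_n$ (`ann n`) and
$b_n^*$ (`cre n`) on a common invariant dense domain `D`, formally adjoint to each other, with the
canonical commutation relations, and a unit vacuum vector that is killed by all $b_n$ and
generates `D`. -/
structure BoseFock (H : Type*) [NormedAddCommGroup H] [InnerProductSpace ℂ H] where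
  D : Submodule ℂ H
  dense_D : Dense (D : Set H)
  ann : ℕ → Module.End ℂ D
  cre : ℕ → Module.End ℂ D
  adjoint : ∀ n (x y : D), inner ℂ (cre n x : H) (y : H) = inner ℂ (x : H) (ann n y : H)
  ann_cre : ∀ n m, ann n * cre m - cre m * ann n = if n = m then 1 else 0
  ann_ann : ∀ n m, ann n * ann m - ann m * ann n = 0
  cre_cre : ∀ n m, cre n * cre m - cre m * cre n = 0
  vac : D
  norm_vac : ‖(vac : H)‖ = 1
  ann_vac : ∀ n, ann n vac = 0
  cyclic : ∀ x : D, ∃ X ∈ Algebra.adjoin ℂ (Set.range ann ∪ Set.range cre), X vac = x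

/-- The Fock representation of fermions on the Hilbert space `H`: bounded operators $a_n$
(`ann n`) with the canonical anticommutation relations, and a cyclic unit vacuum vector that is
killed by all $a_n$. (The anticommutation relations of the $a_n^*$ among themselves are the
adjoints of those in `ann_ann`.) -/
structure FermiFock (H : Type*) [NormedAddCommGroup H] [InnerProductSpace ℂ H]
    [CompleteSpace H] where
  ann : ℕ → (H →L[ℂ] H)
  ann_cre : ∀ n m, ann n * star (ann m) + star (ann m) * ann n = if n = m then 1 else 0
  ann_ann : ∀ n m, ann n * ann m + ann m * ann n = 0
  vac : H
  norm_vac : ‖vac‖ = 1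
  ann_vac : ∀ n, ann n vac = 0
  cyclic : Dense {v : H | ∃ X ∈ StarAlgebra.adjoin ℂ (Set.range ann), X vac = v}

namespace CuntzVacuumRep

variable {H : Type*} [NormedAddCommGroup H] [InnerProductSpace ℂ H] [CompleteSpace H]

/-- The dense subspace spanned by the vectors $t_{i_1} ⋯ t_{i_m} Ω$ with $m ≥ 1$. -/
def D (R : CuntzVacuumRep H) : Submodule ℂ H :=
  Submodule.span ℂ {v | ∃ l : List (Fin 2), l ≠ [] ∧ v = (l.map R.t).prod R.Ω}

/-- The embedded generators $s_m = t_2^{m-1} t_1$ of $O_∞$. -/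
def s (R : CuntzVacuumRep H) (m : ℕ) : H →L[ℂ] H := R.t 1 ^ m * R.t 0

/-- The canonical endomorphism $ρ(x) = ∑_m s_m x s_m^*$, acting on graphs of (unbounded)
operators, the sum being taken in the strong sense: `R.rho G v w` means that `w` is the value of
$ρ(x)$ at `v`, where `G` is the graph of `x`. -/
def rho (R : CuntzVacuumRep H) (G : H → H → Prop) (v w : H) : Prop :=
  ∃ u : ℕ → H, (∀ m, G (star (R.s m) v) (u m)) ∧ HasSum (fun m => R.s m (u m)) w

/-- The recursive boson system $b_1 = ∑_{m ≥ 1} \sqrt m s_m s_{m+1}^*$, $b_n = ρ(b_{n-1})$: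
`R.rbsAnn n v w` means that the series for the `n`-th operator converge at `v`, with value `w`. -/
def rbsAnn (R : CuntzVacuumRep H) : ℕ → H → H → Prop
  | 0 => fun v w =>
      HasSum (fun m : ℕ => ((Real.sqrt (m + 1) : ℝ) : ℂ) • R.s m (star (R.s (m + 1)) v)) w
  | n + 1 => R.rho (R.rbsAnn n)

/-- The adjoint system $b_1^* = ∑_{m ≥ 1} \sqrt m s_{m+1} s_m^*$, $b_n^* = ρ(b_{n-1}^*)$. -/
def rbsCre (R : CuntzVacuumRep H) : ℕ → H → H → Prop
  | 0 => fun v w =>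
      HasSum (fun m : ℕ => ((Real.sqrt (m + 1) : ℝ) : ℂ) • R.s (m + 1) (star (R.s m) v)) w
  | n + 1 => R.rho (R.rbsCre n)

/-- The recursive fermion system $a_1 = t_1 t_2^*$, $a_n = ζ(a_{n-1})$ with
$ζ(y) = t_1 y t_1^* - t_2 y t_2^*$. -/
noncomputable def rfs (R : CuntzVacuumRep H) : ℕ → (H →L[ℂ] H)
  | 0 => R.t 0 * star (R.t 1)
  | n + 1 => R.t 0 * R.rfs n * star (R.t 0) - R.t 1 * R.rfs n * star (R.t 1)

/-- `V` is the unitary $V_B$ with $V_B π_{RBS}(·) V_B^* = π_B$ (on the domain of $π_B$, which is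
the image of the domain of $π_{RBS}$) and $V_B Ω = Ω_B$. -/
structure IsBoseUnitary {K : Type*} [NormedAddCommGroup K] [InnerProductSpace ℂ K]
    (R : CuntzVacuumRep H) (B : BoseFock K) (V : H ≃ₗᵢ[ℂ] K) : Prop where
  map_D : (V : H → K) '' (R.D : Set H) = (B.D : Set K)
  ann : ∀ n (x : B.D), R.rbsAnn n (V.symm (x : K)) (V.symm (B.ann n x : K))
  cre : ∀ n (x : B.D), R.rbsCre n (V.symm (x : K)) (V.symm (B.cre n x : K))
  vac : V R.Ω = B.vac

/-- `V` is the unitary $V_F$ with $V_F π_{RFS}(·) V_F^* = π_F$ and $V_F Ω = Ω_F$. -/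
structure IsFermiUnitary {K : Type*} [NormedAddCommGroup K] [InnerProductSpace ℂ K]
    [CompleteSpace K] (R : CuntzVacuumRep H) (F : FermiFock K) (V : H ≃ₗᵢ[ℂ] K) : Prop where
  ann : ∀ n (y : K), V (R.rfs n (V.symm y)) = F.ann n y
  vac : V R.Ω = F.vac

end CuntzVacuumRep

namespace BoseFock

variable {H : Type*} [NormedAddCommGroup H] [InnerProductSpace ℂ H]

/-- $(b_{n_1}^*)^{k_1} ⋯ (b_{n_m}^*)^{k_m}$. -/
def monomial (B : BoseFock H) {m : ℕ} (n k : Fin m → ℕ) : Module.End ℂ B.D :=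
  (List.ofFn fun i => B.cre (n i) ^ k i).prod

/-- The boson creation monomials, $n_1 < ⋯ < n_m$, all $k_i ≥ 1$ (including `1`, for $m = 0$). -/
def creationMonomials (B : BoseFock H) : Set (Module.End ℂ B.D) :=
  {X | ∃ (m : ℕ) (n k : Fin m → ℕ), StrictMono n ∧ (∀ i, 1 ≤ k i) ∧ X = B.monomial n k}

end BoseFock

namespace FermiFock

variable {H : Type*} [NormedAddCommGroup H] [InnerProductSpace ℂ H] [CompleteSpace H]

/-- The creation operators $a_n^*$. -/
noncomputable def cre (F : FermiFock H) (n : ℕ) : H →L[ℂ] H := star (F.ann n)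

/-- The fermion creation monomials $a_{j_1}^* ⋯ a_{j_l}^*$, $j_1 < ⋯ < j_l$
(including `1`, for $l = 0$). -/
def creationMonomials (F : FermiFock H) : Set (H →L[ℂ] H) :=
  {Y | ∃ (l : ℕ) (j : Fin l → ℕ), StrictMono j ∧ Y = (List.ofFn fun i => F.cre (j i)).prod}

/-- The block $A_{n,m} = a_{n+1}^* ⋯ a_{n+m}^*$; with modes numbered from `0` this is the product
of the `cre (n + j)` for `j = 0, …, m - 1`. -/
noncomputable def A (F : FermiFock H) (n m : ℕ) : H →L[ℂ] H :=
  ((List.range m).map fun j => F.cre (n + j)).prod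

/-- $A_{n_1 - 1, k_1} A_{n_2 + k_1 - 1, k_2} ⋯ A_{n_m + k_1 + ⋯ + k_{m-1} - 1, k_m}$; since modes
are numbered from `0`, the argument `n i` stands for $n_i - 1$. -/
noncomputable def blocks (F : FermiFock H) {m : ℕ} (n k : Fin m → ℕ) : H →L[ℂ] H :=
  (List.ofFn fun i => F.A (n i + ∑ j ∈ Finset.Iio i, k j) (k i)).prod

end FermiFock

/-! Both Fock spaces are realised on `H`, where the boson and fermion monomials produce the same
vectors up to a scalar. Number modes from 0. Since `s j` intertwines $b_n^*$ with $b_{n+1}^*$ and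
$(b_0^*)^k$ `s 0` $= \sqrt{k!}$ `s k`, the boson monomial with modes $n_i$ and exponents $k_i$ sends
`Ω` to $\sqrt{\prod k_i!}$ times the word $t_0^{n_1} t_1^{k_1} t_0^{n_2-n_1} t_1^{k_2} \cdots
t_1^{k_m}Ω$. On the fermion side, $a_j^*$ turns the letter $t_0$ in position $j$ into $t_1$, with a
sign for each $t_1$ to its left. In an ordered product the rightmost factor acts first, so no sign
occurs. The word above is therefore the fermion monomial whose modes are the positions of its
letters $t_1$, and these are the displaced blocks (`exists_word_bosonModes`, `word_bosonModes`).
That every increasing list of modes splits uniquely into such blocks is combinatorics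
(`exists_blockModes_eq`, `blockModes_injOn`). The unitaries exist because the inner products of
creation words follow from the commutation relations and the vacuum alone
(`LadderSystem.inner_word`), and these words are total in all three spaces. A unitary is admissible
exactly when it matches creation words (`isBoseUnitary_iff`, `isFermiUnitary_iff`), which also gives
uniqueness. -/

section Unitary

/-! ### Unitaries from Gram matrices. -/

variable {H K : Type*} [NormedAddCommGroup H] [InnerProductSpace ℂ H]
  [NormedAddCommGroup K] [InnerProductSpace ℂ K]

theorem norm_linearCombination_eq_of_gram {ι : Type*} {v : ι → H} {w : ι → K}
    (h : ∀ i j, inner ℂ (v i) (v j) = inner ℂ (w i) (w j)) (f : ι →₀ ℂ) :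
    ‖Finsupp.linearCombination ℂ v f‖ = ‖Finsupp.linearCombination ℂ w f‖ := by
  have : (inner ℂ (Finsupp.linearCombination ℂ v f) (Finsupp.linearCombination ℂ v f) : ℂ) =
      inner ℂ (Finsupp.linearCombination ℂ w f) (Finsupp.linearCombination ℂ w f) := by
    simp only [Finsupp.linearCombination_apply, Finsupp.sum_inner, Finsupp.inner_sum,
      inner_smul_left, inner_smul_right, h]
  rw [@norm_eq_sqrt_re_inner ℂ, this, ← @norm_eq_sqrt_re_inner ℂ]

/-- Two total families of vectors with the same Gram matrix are unitarily equivalent. -/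
theorem exists_linearIsometryEquiv_of_gram [CompleteSpace H] [CompleteSpace K] {ι : Type*}
    {v : ι → H} {w : ι → K} (h : ∀ i j, inner ℂ (v i) (v j) = inner ℂ (w i) (w j))
    (hv : Dense (Submodule.span ℂ (Set.range v) : Set H))
    (hw : Dense (Submodule.span ℂ (Set.range w) : Set K)) :
    ∃ V : H ≃ₗᵢ[ℂ] K, ∀ i, V (v i) = w i := by
  have hv' : DenseRange (Finsupp.linearCombination ℂ v) := by
    rw [DenseRange, ← LinearMap.coe_range, Finsupp.range_linearCombination]; exact hv
  have hw' : DenseRange (Finsupp.linearCombination ℂ w) := by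
    rw [DenseRange, ← LinearMap.coe_range, Finsupp.range_linearCombination]; exact hw
  let V := (LinearEquiv.refl ℂ (ι →₀ ℂ)).extendOfIsometry _ _ hv' hw'
    fun x => (norm_linearCombination_eq_of_gram h x).symm
  refine ⟨V, fun i => ?_⟩
  have := (LinearEquiv.refl ℂ (ι →₀ ℂ)).extendOfIsometry_eq _ _ hv' hw'
    (fun x => (norm_linearCombination_eq_of_gram h x).symm) (Finsupp.single i 1)
  simpa using this

/-- Creation words involve adjoints, while the condition on $V_F$ concerns annihilators; this passes
between the two. -/
theorem map_star_apply_of_intertwines [CompleteSpace H] [CompleteSpace K] (V : H ≃ₗᵢ[ℂ] K)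
    {A : H →L[ℂ] H} {B : K →L[ℂ] K} (h : ∀ x, V (A x) = B (V x)) (x : H) :
    V (star A x) = star B (V x) := by
  refine ext_inner_right ℂ fun y => ?_
  obtain ⟨z, rfl⟩ := V.surjective y
  rw [V.inner_map_map, ContinuousLinearMap.star_eq_adjoint, ContinuousLinearMap.star_eq_adjoint,
    ContinuousLinearMap.adjoint_inner_left, ContinuousLinearMap.adjoint_inner_left, ← h,
    V.inner_map_map]

end Unitary

/-! ### Ladder systems: bosons for $q = 1$, fermions for $q = -1$. -/

/-- Annihilation and creation operators with $a_n a_m^* = δ_{nm} + q a_m^* a_n$ and a vacuum. -/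
structure LadderSystem (q : ℂ) (E : Type*) [NormedAddCommGroup E] [InnerProductSpace ℂ E] where
  ann : ℕ → Module.End ℂ E
  cre : ℕ → Module.End ℂ E
  adjoint : ∀ n x y, inner ℂ (cre n x) y = inner ℂ x (ann n y)
  ann_cre : ∀ n m x, ann n (cre m x) = (if n = m then x else 0) + q • cre m (ann n x)
  vac : E
  norm_vac : ‖vac‖ = 1
  ann_vac : ∀ n, ann n vac = 0

namespace LadderSystem

variable {q : ℂ} {E E' : Type*} [NormedAddCommGroup E] [InnerProductSpace ℂ E]
  [NormedAddCommGroup E'] [InnerProductSpace ℂ E']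

/-- The product of the creation operators with modes in `l`, applied to the vacuum. -/
def word (S : LadderSystem q E) (l : List ℕ) : E := (l.map S.cre).prod S.vac

@[simp] theorem word_nil (S : LadderSystem q E) : S.word [] = S.vac := rfl

@[simp] theorem word_cons (S : LadderSystem q E) (n : ℕ) (l : List ℕ) :
    S.word (n :: l) = S.cre n (S.word l) := by
  simp [word]

/-- Moving the annihilator to the right until it meets the vacuum uses only the relations, so the
same coefficients `c` serve every system with this `q`. -/
theorem ann_word (S : LadderSystem q E) (S' : LadderSystem q E') (n : ℕ) (l : List ℕ) :
    ∃ c : List ℕ →₀ ℂ, S.ann n (S.word l) = Finsupp.linearCombination ℂ S.word c ∧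
      S'.ann n (S'.word l) = Finsupp.linearCombination ℂ S'.word c := by
  induction l with
  | nil => exact ⟨0, by simp [S.ann_vac], by simp [S'.ann_vac]⟩
  | cons m l ih =>
    obtain ⟨c, h, h'⟩ := ih
    refine ⟨Finsupp.single l (if n = m then 1 else 0) + q • Finsupp.mapDomain (List.cons m) c,
      ?_, ?_⟩
    · have : S.word ∘ List.cons m = S.cre m ∘ S.word := by ext; simp
      rw [word_cons, S.ann_cre, h, map_add, map_smul, Finsupp.linearCombination_mapDomain, this,
        Finsupp.linearCombination_single, Finsupp.linearCombination_linear_comp]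
      simp
    · have : S'.word ∘ List.cons m = S'.cre m ∘ S'.word := by ext; simp
      rw [word_cons, S'.ann_cre, h', map_add, map_smul, Finsupp.linearCombination_mapDomain, this,
        Finsupp.linearCombination_single, Finsupp.linearCombination_linear_comp]
      simp

theorem ann_word_mem_span (S : LadderSystem q E) (n : ℕ) (l : List ℕ) :
    S.ann n (S.word l) ∈ Submodule.span ℂ (Set.range S.word) := by
  obtain ⟨c, h, -⟩ := S.ann_word S n l
  rw [h, ← Finsupp.range_linearCombination]
  exact LinearMap.mem_range_self _ _

theorem cre_mem_span_word (S : LadderSystem q E) (n : ℕ) {x : E}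
    (hx : x ∈ Submodule.span ℂ (Set.range S.word)) :
    S.cre n x ∈ Submodule.span ℂ (Set.range S.word) := by
  refine (Submodule.span_le (p := (Submodule.span ℂ (Set.range S.word)).comap (S.cre n))).2 ?_ hx
  rintro _ ⟨l, rfl⟩
  exact Submodule.subset_span ⟨n :: l, by simp⟩

theorem ann_mem_span_word (S : LadderSystem q E) (n : ℕ) {x : E}
    (hx : x ∈ Submodule.span ℂ (Set.range S.word)) :
    S.ann n x ∈ Submodule.span ℂ (Set.range S.word) := by
  refine (Submodule.span_le (p := (Submodule.span ℂ (Set.range S.word)).comap (S.ann n))).2 ?_ hx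
  rintro _ ⟨l, rfl⟩
  exact S.ann_word_mem_span n l

/-- The Gram matrix of the creation words only depends on `q`. -/
theorem inner_word (S : LadderSystem q E) (S' : LadderSystem q E') (l l' : List ℕ) :
    inner ℂ (S.word l) (S.word l') = inner ℂ (S'.word l) (S'.word l') := by
  induction l generalizing l' with
  | nil =>
    cases l' with
    | nil => simp [inner_self_eq_norm_sq_to_K, S.norm_vac, S'.norm_vac]
    | cons m l' =>
      rw [word_nil, word_nil, word_cons, word_cons, ← inner_conj_symm, S.adjoint,
        ← inner_conj_symm (S'.vac), S'.adjoint, S.ann_vac, S'.ann_vac]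
      simp
  | cons n l ih =>
    obtain ⟨c, h, h'⟩ := S.ann_word S' n l'
    rw [word_cons, word_cons, S.adjoint, S'.adjoint, h, h']
    simp only [Finsupp.linearCombination_apply, Finsupp.inner_sum, inner_smul_right, ih]

end LadderSystem

/-! ### The isometries `s m` and graphs of unbounded operators. -/

namespace CuntzVacuumRep

variable {H : Type*} [NormedAddCommGroup H] [InnerProductSpace ℂ H] [CompleteSpace H]

theorem star_t_t (R : CuntzVacuumRep H) (i j : Fin 2) (v : H) :
    star (R.t i) (R.t j v) = if i = j then v else 0 := by
  change (star (R.t i) * R.t j) v = _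
  rw [R.star_mul]
  split_ifs <;> rfl

@[simp] theorem s_zero_apply (R : CuntzVacuumRep H) (v : H) : R.s 0 v = R.t 0 v := by
  simp [s]

theorem s_succ_apply (R : CuntzVacuumRep H) (m : ℕ) (v : H) :
    R.s (m + 1) v = R.t 1 (R.s m v) := by
  simp [s, pow_succ', mul_assoc]

@[simp] theorem star_s_zero_apply (R : CuntzVacuumRep H) (v : H) :
    star (R.s 0) v = star (R.t 0) v := by
  simp [s]

theorem star_s_succ_apply (R : CuntzVacuumRep H) (m : ℕ) (v : H) :
    star (R.s (m + 1)) v = star (R.s m) (star (R.t 1) v) := by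
  have : R.s (m + 1) = R.t 1 * R.s m := by rw [s, pow_succ', mul_assoc, s]
  rw [this, StarMul.star_mul]
  rfl

theorem star_s_s (R : CuntzVacuumRep H) (j k : ℕ) (v : H) :
    star (R.s j) (R.s k v) = if j = k then v else 0 := by
  induction j generalizing k with
  | zero => cases k <;> simp [s_succ_apply, star_t_t]
  | succ j ih =>
    cases k with
    | zero => simp [star_s_succ_apply, star_t_t]
    | succ k => simp [star_s_succ_apply, s_succ_apply, star_t_t, ih]

theorem inner_s_s (R : CuntzVacuumRep H) (j k : ℕ) (v w : H) :
    inner ℂ (R.s j v) (R.s k w) = if j = k then inner ℂ v w else 0 := by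
  rw [← ContinuousLinearMap.adjoint_inner_right, ← ContinuousLinearMap.star_eq_adjoint, star_s_s]
  split_ifs <;> simp

/-- `G` is the graph of a linear operator. -/
structure IsOperatorGraph (G : H → H → Prop) : Prop where
  zero : G 0 0
  add : ∀ {v w v' w'}, G v w → G v' w' → G (v + v') (w + w')
  smul : ∀ (c : ℂ) {v w}, G v w → G (c • v) (c • w)
  unique : ∀ {v w w'}, G v w → G v w' → w = w'

theorem IsOperatorGraph.rho (R : CuntzVacuumRep H) {G : H → H → Prop} (hG : IsOperatorGraph G) :
    IsOperatorGraph (R.rho G) where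
  zero := ⟨0, fun m => by simpa using hG.zero, by simp⟩
  add := by
    rintro v w v' w' ⟨u, hu, h⟩ ⟨u', hu', h'⟩
    exact ⟨u + u', fun m => by simpa using hG.add (hu m) (hu' m), by simpa using h.add h'⟩
  smul := by
    rintro c v w ⟨u, hu, h⟩
    exact ⟨c • u, fun m => by simpa using hG.smul c (hu m), by simpa using h.const_smul c⟩
  unique := by
    rintro v w w' ⟨u, hu, h⟩ ⟨u', hu', h'⟩
    obtain rfl : u = u' := funext fun m => hG.unique (hu m) (hu' m)
    exact h.unique h'

omit [CompleteSpace H] in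
theorem isOperatorGraph_hasSum (T : ℕ → H →L[ℂ] H) :
    IsOperatorGraph fun v w => HasSum (fun m => T m v) w where
  zero := by simp
  add h h' := by simpa using h.add h'
  smul c _ _ h := by simpa using h.const_smul c
  unique h h' := h.unique h'

theorem isOperatorGraph_rbsAnn (R : CuntzVacuumRep H) (n : ℕ) : IsOperatorGraph (R.rbsAnn n) := by
  induction n with
  | zero =>
    exact isOperatorGraph_hasSum
      fun m => ((Real.sqrt (m + 1) : ℝ) : ℂ) • (R.s m * star (R.s (m + 1)))
  | succ n ih => exact ih.rho R

theorem isOperatorGraph_rbsCre (R : CuntzVacuumRep H) (n : ℕ) : IsOperatorGraph (R.rbsCre n) := by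
  induction n with
  | zero =>
    exact isOperatorGraph_hasSum
      fun m => ((Real.sqrt (m + 1) : ℝ) : ℂ) • (R.s (m + 1) * star (R.s m))
  | succ n ih => exact ih.rho R

/-- This is $ρ(x) s_j = s_j x$: by orthogonality of the ranges only the term $m = j$ survives. -/
theorem rho_s (R : CuntzVacuumRep H) {G : H → H → Prop} (hG : IsOperatorGraph G) (j : ℕ) {v w : H}
    (h : G v w) : R.rho G (R.s j v) (R.s j w) := by
  refine ⟨Pi.single j w, fun m => ?_, ?_⟩
  · rw [star_s_s]
    rcases eq_or_ne m j with rfl | hm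
    · simpa using h
    · simpa [hm] using hG.zero
  · simpa using hasSum_single (f := fun m => R.s m (Pi.single (M := fun _ => H) j w m)) j
      fun m hm => by simp [hm]

theorem rbsCre_zero_s (R : CuntzVacuumRep H) (j : ℕ) (v : H) :
    R.rbsCre 0 (R.s j v) (((Real.sqrt (j + 1) : ℝ) : ℂ) • R.s (j + 1) v) := by
  change HasSum (fun m : ℕ => ((Real.sqrt (m + 1) : ℝ) : ℂ) • R.s (m + 1) (star (R.s m) _)) _
  convert hasSum_single (f := fun m : ℕ =>
    ((Real.sqrt (m + 1) : ℝ) : ℂ) • R.s (m + 1) (star (R.s m) (R.s j v))) j ?_ using 1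
  · rw [star_s_s, if_pos rfl]
  · intro m hm
    rw [star_s_s, if_neg hm, map_zero, smul_zero]

theorem rbsAnn_zero_s_zero (R : CuntzVacuumRep H) (v : H) : R.rbsAnn 0 (R.s 0 v) 0 := by
  change HasSum (fun m : ℕ => ((Real.sqrt (m + 1) : ℝ) : ℂ) • R.s m (star (R.s (m + 1)) _)) _
  simpa only [star_s_s, Nat.succ_ne_zero, if_false, map_zero, smul_zero] using hasSum_zero

theorem rbsAnn_zero_s_succ (R : CuntzVacuumRep H) (j : ℕ) (v : H) :
    R.rbsAnn 0 (R.s (j + 1) v) (((Real.sqrt (j + 1) : ℝ) : ℂ) • R.s j v) := by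
  change HasSum (fun m : ℕ => ((Real.sqrt (m + 1) : ℝ) : ℂ) • R.s m (star (R.s (m + 1)) _)) _
  convert hasSum_single (f := fun m : ℕ =>
    ((Real.sqrt (m + 1) : ℝ) : ℂ) • R.s m (star (R.s (m + 1)) (R.s (j + 1) v))) j ?_ using 1
  · rw [star_s_s, if_pos rfl]
  · intro m hm
    rw [star_s_s, if_neg (by simpa using hm), map_zero, smul_zero]

/-! ### The domain `D` -/

theorem t_mem_D (R : CuntzVacuumRep H) (i : Fin 2) {v : H} (hv : v ∈ R.D) : R.t i v ∈ R.D := by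
  refine (Submodule.span_le (p := R.D.comap (R.t i).toLinearMap)).2 ?_ hv
  rintro _ ⟨l, -, rfl⟩
  exact Submodule.subset_span ⟨i :: l, by simp, by simp⟩

theorem Ω_mem_D (R : CuntzVacuumRep H) : R.Ω ∈ R.D :=
  Submodule.subset_span ⟨[0], by simp, by simp [R.t_Ω]⟩

theorem D_le (R : CuntzVacuumRep H) {p : Submodule ℂ H} (h : R.Ω ∈ p)
    (ht : ∀ i, ∀ v ∈ p, R.t i v ∈ p) : R.D ≤ p := by
  refine Submodule.span_le.2 ?_
  rintro _ ⟨l, -, rfl⟩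
  induction l with
  | nil => simpa using h
  | cons i l ih => simpa using ht i _ ih

theorem star_t_mem_D (R : CuntzVacuumRep H) (i : Fin 2) {v : H} (hv : v ∈ R.D) :
    star (R.t i) v ∈ R.D := by
  suffices h : R.D ≤ R.D ⊓ R.D.comap (star (R.t i)).toLinearMap from (h hv).2
  refine R.D_le ⟨R.Ω_mem_D, ?_⟩ fun j v hv => ⟨R.t_mem_D j hv.1, ?_⟩
  -- The vacuum is in the range of `t 0`, because `Ω` equals `t 0 Ω`.
  · have := R.star_t_t i 0 R.Ω
    rw [R.t_Ω] at this
    change star (R.t i) R.Ω ∈ R.D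
    rw [this]
    split_ifs
    exacts [R.Ω_mem_D, R.D.zero_mem]
  · change star (R.t i) (R.t j v) ∈ R.D
    rw [star_t_t]
    split_ifs
    exacts [hv.1, R.D.zero_mem]

theorem dense_D (R : CuntzVacuumRep H) : Dense (R.D : Set H) := by
  refine R.cyclic.mono ?_
  rintro _ ⟨X, hX, rfl⟩
  suffices h : ∀ v ∈ R.D, X v ∈ R.D from h _ R.Ω_mem_D
  rw [← StarSubalgebra.mem_toSubalgebra, StarAlgebra.adjoin_toSubalgebra] at hX
  induction hX using Algebra.adjoin_induction with
  | mem X hX =>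
    rintro v hv
    rcases hX with ⟨i, rfl⟩ | ⟨i, hi⟩
    · exact R.t_mem_D i hv
    · rw [← star_star X, ← hi]
      exact R.star_t_mem_D i hv
  | algebraMap c =>
    intro v hv
    rw [Algebra.algebraMap_eq_smul_one]
    simpa using R.D.smul_mem c hv
  | add X Y _ _ hX hY => exact fun v hv => R.D.add_mem (hX v hv) (hY v hv)
  | mul X Y _ _ hX hY => exact fun v hv => hX _ (hY v hv)

theorem s_mem_D (R : CuntzVacuumRep H) (m : ℕ) {v : H} (hv : v ∈ R.D) : R.s m v ∈ R.D := by
  induction m with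
  | zero => simpa using R.t_mem_D 0 hv
  | succ m ih => rw [s_succ_apply]; exact R.t_mem_D 1 ih

theorem prod_s_mem_D (R : CuntzVacuumRep H) (L : List ℕ) : (L.map R.s).prod R.Ω ∈ R.D := by
  induction L with
  | nil => simpa using R.Ω_mem_D
  | cons m L ih => simpa using R.s_mem_D m ih

/-- A word in the `t i` ending in letters `t 1` becomes a word in the `s m` once `Ω` is rewritten as
`t 0 Ω`. -/
theorem D_le_of_prod_s (R : CuntzVacuumRep H) {p : Submodule ℂ H}
    (h : ∀ L : List ℕ, (L.map R.s).prod R.Ω ∈ p) : R.D ≤ p := by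
  refine Submodule.span_le.2 ?_
  rintro _ ⟨l, -, rfl⟩
  suffices ∃ L : List ℕ, (l.map R.t).prod R.Ω = (L.map R.s).prod R.Ω by
    obtain ⟨L, hL⟩ := this
    rw [hL]; exact h L
  induction l with
  | nil => exact ⟨[], rfl⟩
  | cons i l ih =>
    obtain ⟨L, hL⟩ := ih
    match i with
    | 0 => exact ⟨0 :: L, by simp [hL]⟩
    | 1 =>
      cases L with
      | nil => exact ⟨[1], by simp [hL, R.t_Ω, s_succ_apply R 0]⟩
      | cons m L => exact ⟨(m + 1) :: L, by simp [hL, s_succ_apply]⟩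

/-- Operators on `D` may be compared on the vectors `s j v` alone; even `Ω` is of this form. -/
theorem D_le_of_s (R : CuntzVacuumRep H) {p : Submodule ℂ H}
    (h : ∀ j, ∀ v ∈ R.D, R.s j v ∈ p) : R.D ≤ p := by
  refine R.D_le_of_prod_s fun L => ?_
  cases L with
  | nil => simpa [R.t_Ω] using h 0 _ R.Ω_mem_D
  | cons m L => simpa using h m _ (R.prod_s_mem_D L)

/-- Linearity of the graph spreads totality from a spanning set to `D`; uniqueness of values makes
the chosen function linear. -/
theorem IsOperatorGraph.exists_end {G : H → H → Prop} (hG : IsOperatorGraph G)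
    (R : CuntzVacuumRep H) (h : ∀ L : List ℕ, ∃ w ∈ R.D, G ((L.map R.s).prod R.Ω) w) :
    ∃ T : Module.End ℂ R.D, ∀ x : R.D, G x (T x) := by
  have total : ∀ x : R.D, ∃ w : R.D, G x w := by
    let p : Submodule ℂ H :=
      { carrier := {v | ∃ w : R.D, G v w}
        zero_mem' := ⟨0, by simpa using hG.zero⟩
        add_mem' := fun ⟨w, hw⟩ ⟨w', hw'⟩ => ⟨w + w', by simpa using hG.add hw hw'⟩
        smul_mem' := fun c v ⟨w, hw⟩ => ⟨c • w, by simpa using hG.smul c hw⟩ }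
    intro x
    refine R.D_le_of_prod_s (p := p) (fun L => ?_) x.2
    obtain ⟨w, hw, h⟩ := h L
    exact ⟨⟨w, hw⟩, h⟩
  choose T hT using total
  exact ⟨{ toFun := T
           map_add' := fun x y => Subtype.ext (hG.unique (hT _) (hG.add (hT x) (hT y)))
           map_smul' := fun c x => Subtype.ext (hG.unique (hT _) (hG.smul c (hT x))) }, hT⟩

theorem forall_prod_s (R : CuntzVacuumRep H) {P : H → Prop}
    (h : ∀ (m : ℕ) (L : List ℕ), P (R.s m ((L.map R.s).prod R.Ω))) (L : List ℕ) :
    P ((L.map R.s).prod R.Ω) := by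
  cases L with
  | nil => simpa [R.t_Ω] using h 0 []
  | cons m L => simpa using h m L

theorem exists_rbsCre (R : CuntzVacuumRep H) (n : ℕ) (L : List ℕ) :
    ∃ w ∈ R.D, R.rbsCre n ((L.map R.s).prod R.Ω) w := by
  induction n generalizing L with
  | zero =>
    refine R.forall_prod_s (P := fun v => ∃ w ∈ R.D, R.rbsCre 0 v w)
      (fun m L => ⟨_, ?_, R.rbsCre_zero_s m _⟩) L
    exact R.D.smul_mem _ (R.s_mem_D _ (R.prod_s_mem_D L))
  | succ n ih =>
    refine R.forall_prod_s (P := fun v => ∃ w ∈ R.D, R.rbsCre (n + 1) v w) (fun m L => ?_) L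
    obtain ⟨w, hw, h⟩ := ih L
    exact ⟨_, R.s_mem_D m hw, R.rho_s (R.isOperatorGraph_rbsCre n) m h⟩

theorem exists_rbsAnn (R : CuntzVacuumRep H) (n : ℕ) (L : List ℕ) :
    ∃ w ∈ R.D, R.rbsAnn n ((L.map R.s).prod R.Ω) w := by
  induction n generalizing L with
  | zero =>
    refine R.forall_prod_s (P := fun v => ∃ w ∈ R.D, R.rbsAnn 0 v w) (fun m L => ?_) L
    cases m with
    | zero => exact ⟨_, R.D.zero_mem, R.rbsAnn_zero_s_zero _⟩
    | succ m =>
      exact ⟨_, R.D.smul_mem _ (R.s_mem_D _ (R.prod_s_mem_D L)), R.rbsAnn_zero_s_succ m _⟩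
  | succ n ih =>
    refine R.forall_prod_s (P := fun v => ∃ w ∈ R.D, R.rbsAnn (n + 1) v w) (fun m L => ?_) L
    obtain ⟨w, hw, h⟩ := ih L
    exact ⟨_, R.s_mem_D m hw, R.rho_s (R.isOperatorGraph_rbsAnn n) m h⟩

/-! ### The recursive boson system as operators on `D` -/

/-- The operator $b_n^*$ of the recursive boson system on `D`. -/
noncomputable def boseCre (R : CuntzVacuumRep H) (n : ℕ) : Module.End ℂ R.D :=
  ((R.isOperatorGraph_rbsCre n).exists_end R (R.exists_rbsCre n)).choose

/-- The operator $b_n$ of the recursive boson system on `D`. -/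
noncomputable def boseAnn (R : CuntzVacuumRep H) (n : ℕ) : Module.End ℂ R.D :=
  ((R.isOperatorGraph_rbsAnn n).exists_end R (R.exists_rbsAnn n)).choose

theorem rbsCre_boseCre (R : CuntzVacuumRep H) (n : ℕ) (x : R.D) :
    R.rbsCre n x (R.boseCre n x) :=
  ((R.isOperatorGraph_rbsCre n).exists_end R (R.exists_rbsCre n)).choose_spec x

theorem rbsAnn_boseAnn (R : CuntzVacuumRep H) (n : ℕ) (x : R.D) :
    R.rbsAnn n x (R.boseAnn n x) :=
  ((R.isOperatorGraph_rbsAnn n).exists_end R (R.exists_rbsAnn n)).choose_spec x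

/-- The restriction of `s m` to `D`. -/
def sD (R : CuntzVacuumRep H) (m : ℕ) : Module.End ℂ R.D :=
  (R.s m).toLinearMap.restrict fun _ hv => R.s_mem_D m hv

@[simp] theorem coe_sD (R : CuntzVacuumRep H) (m : ℕ) (x : R.D) : (R.sD m x : H) = R.s m x := rfl

theorem boseCre_zero_sD (R : CuntzVacuumRep H) (j : ℕ) (x : R.D) :
    R.boseCre 0 (R.sD j x) = ((Real.sqrt (j + 1) : ℝ) : ℂ) • R.sD (j + 1) x :=
  Subtype.ext <| (R.isOperatorGraph_rbsCre 0).unique (R.rbsCre_boseCre 0 _) (R.rbsCre_zero_s j x)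

theorem boseCre_succ_sD (R : CuntzVacuumRep H) (n j : ℕ) (x : R.D) :
    R.boseCre (n + 1) (R.sD j x) = R.sD j (R.boseCre n x) :=
  Subtype.ext <| (R.isOperatorGraph_rbsCre (n + 1)).unique (R.rbsCre_boseCre _ _)
    (R.rho_s (R.isOperatorGraph_rbsCre n) j (R.rbsCre_boseCre n x))

theorem boseAnn_zero_sD_zero (R : CuntzVacuumRep H) (x : R.D) : R.boseAnn 0 (R.sD 0 x) = 0 :=
  Subtype.ext <| (R.isOperatorGraph_rbsAnn 0).unique (R.rbsAnn_boseAnn 0 _) (R.rbsAnn_zero_s_zero x)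

theorem boseAnn_zero_sD_succ (R : CuntzVacuumRep H) (j : ℕ) (x : R.D) :
    R.boseAnn 0 (R.sD (j + 1) x) = ((Real.sqrt (j + 1) : ℝ) : ℂ) • R.sD j x :=
  Subtype.ext <| (R.isOperatorGraph_rbsAnn 0).unique (R.rbsAnn_boseAnn 0 _)
    (R.rbsAnn_zero_s_succ j x)

theorem boseAnn_succ_sD (R : CuntzVacuumRep H) (n j : ℕ) (x : R.D) :
    R.boseAnn (n + 1) (R.sD j x) = R.sD j (R.boseAnn n x) :=
  Subtype.ext <| (R.isOperatorGraph_rbsAnn (n + 1)).unique (R.rbsAnn_boseAnn _ _)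
    (R.rho_s (R.isOperatorGraph_rbsAnn n) j (R.rbsAnn_boseAnn n x))

theorem eq_top_of_sD (R : CuntzVacuumRep H) {p : Submodule ℂ R.D}
    (h : ∀ j x, R.sD j x ∈ p) : p = ⊤ := by
  refine eq_top_iff.2 fun x _ => ?_
  obtain ⟨y, hy, hxy⟩ := R.D_le_of_s (p := p.map R.D.subtype)
    (fun j v hv => ⟨R.sD j ⟨v, hv⟩, h _ _, rfl⟩) x.2
  rwa [← Subtype.ext hxy]

theorem end_ext_sD (R : CuntzVacuumRep H) {S T : Module.End ℂ R.D}
    (h : ∀ j x, S (R.sD j x) = T (R.sD j x)) : S = T :=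
  LinearMap.eqLocus_eq_top.1 (R.eq_top_of_sD (p := LinearMap.eqLocus S T) h)

theorem inner_sD_sD (R : CuntzVacuumRep H) (j k : ℕ) (x y : R.D) :
    inner ℂ (R.sD j x) (R.sD k y) = if j = k then inner ℂ x y else 0 :=
  R.inner_s_s j k x y

theorem sqrt_succ_smul_sqrt_succ_smul {M : Type*} [AddCommGroup M] [Module ℂ M] (j : ℕ) (x : M) :
    ((Real.sqrt (j + 1) : ℝ) : ℂ) • ((Real.sqrt (j + 1) : ℝ) : ℂ) • x = (j + 1 : ℂ) • x := by
  rw [smul_smul, ← Complex.ofReal_mul, Real.mul_self_sqrt (by positivity)]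
  simp

/-- On vectors `s j x`, mode 0 is a harmonic oscillator in `j`, with $(j+1) - j = 1$, whereas mode
`n + 1` acts as mode `n` on `x`. Mixed pairs thus commute, and equal or unequal successors reduce to
the preceding pair. -/
theorem boseAnn_mul_boseCre (R : CuntzVacuumRep H) (n m : ℕ) :
    R.boseAnn n * R.boseCre m = (if n = m then 1 else 0) + R.boseCre m * R.boseAnn n := by
  induction n generalizing m with
  | zero =>
    refine R.end_ext_sD fun j x => ?_
    cases m with
    | zero =>
      cases j with
      | zero => simp [boseCre_zero_sD, boseAnn_zero_sD_zero, boseAnn_zero_sD_succ R 0]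
      | succ j =>
        simp only [Module.End.mul_apply, boseCre_zero_sD, boseAnn_zero_sD_succ, map_smul, if_true,
          LinearMap.add_apply, Module.End.one_apply, sqrt_succ_smul_sqrt_succ_smul]
        push_cast
        module
    | succ m =>
      cases j with
      | zero => simp [boseCre_succ_sD, boseAnn_zero_sD_zero]
      | succ j => simp [boseCre_succ_sD, boseAnn_zero_sD_succ]
  | succ n ih =>
    refine R.end_ext_sD fun j x => ?_
    cases m with
    | zero => simp [boseCre_zero_sD, boseAnn_succ_sD]
    | succ m =>
      have := congrArg (R.sD j) (LinearMap.congr_fun (ih m) x)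
      simp only [Module.End.mul_apply, LinearMap.add_apply, map_add] at this
      simp only [Module.End.mul_apply, LinearMap.add_apply, boseCre_succ_sD, boseAnn_succ_sD, this,
        Nat.succ_inj]
      split_ifs <;> simp

theorem inner_boseCre (R : CuntzVacuumRep H) (n : ℕ) (x y : R.D) :
    inner ℂ (R.boseCre n x) y = inner ℂ x (R.boseAnn n y) := by
  -- The adjoint relation is checked on vectors `s j x`, `s k y`, given the preceding mode;
  -- sesquilinearity then extends it one argument at a time.
  suffices h : ∀ n, ∀ j x k y, (∀ m, n = m + 1 → inner ℂ (R.boseCre m x) y =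
      inner ℂ x (R.boseAnn m y)) → inner ℂ (R.boseCre n (R.sD j x)) (R.sD k y) =
        inner ℂ (R.sD j x) (R.boseAnn n (R.sD k y)) by
    have ext : ∀ n, (∀ j x k y, inner ℂ (R.boseCre n (R.sD j x)) (R.sD k y) =
        inner ℂ (R.sD j x) (R.boseAnn n (R.sD k y))) → ∀ x y,
        inner ℂ (R.boseCre n x) y = inner ℂ x (R.boseAnn n y) := by
      intro n h x y
      let B₁ : R.D →ₗ⋆[ℂ] R.D →ₗ[ℂ] ℂ := (innerₛₗ ℂ).comp (R.boseCre n)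
      let B₂ : R.D →ₗ⋆[ℂ] R.D →ₗ[ℂ] ℂ := (innerₛₗ ℂ).compl₂ (R.boseAnn n)
      have h₁ : ∀ j x, B₁ (R.sD j x) = B₂ (R.sD j x) := fun j x =>
        LinearMap.eqLocus_eq_top.1 (R.eq_top_of_sD (p := LinearMap.eqLocus _ _) (h j x))
      have h₂ : B₁ = B₂ :=
        LinearMap.eqLocus_eq_top.1 (R.eq_top_of_sD (p := LinearMap.eqLocus B₁ B₂) h₁)
      exact LinearMap.congr_fun₂ h₂ x y
    induction n generalizing x y with
    | zero => exact ext 0 (fun j x k y => h 0 j x k y (by simp)) x y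
    | succ n ih =>
      exact ext (n + 1) (fun j x k y => h (n + 1) j x k y (by rintro m ⟨⟩; exact ih x y)) x y
  intro n j x k y h
  cases n with
  | zero =>
    rw [boseCre_zero_sD]
    cases k with
    | zero => rw [boseAnn_zero_sD_zero, inner_smul_left, inner_sD_sD]; simp
    | succ k =>
      rw [boseAnn_zero_sD_succ, inner_smul_left, inner_smul_right, inner_sD_sD, inner_sD_sD,
        Complex.conj_ofReal]
      rcases eq_or_ne j k with rfl | hjk
      · simp
      · simp [hjk]
  | succ n =>
    rw [boseCre_succ_sD, boseAnn_succ_sD, inner_sD_sD, inner_sD_sD, h n rfl]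

/-- The vector `Ω` as an element of `D`. -/
def ΩD (R : CuntzVacuumRep H) : R.D := ⟨R.Ω, R.Ω_mem_D⟩

theorem sD_zero_ΩD (R : CuntzVacuumRep H) : R.sD 0 R.ΩD = R.ΩD :=
  Subtype.ext (by simp [ΩD, R.t_Ω])

theorem boseAnn_ΩD (R : CuntzVacuumRep H) (n : ℕ) : R.boseAnn n R.ΩD = 0 := by
  induction n with
  | zero => rw [← sD_zero_ΩD, boseAnn_zero_sD_zero]
  | succ n ih => rw [← sD_zero_ΩD, boseAnn_succ_sD, ih, map_zero]

/-- The recursive boson system on `D` with the vacuum `Ω`. -/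
noncomputable def boseLadder (R : CuntzVacuumRep H) : LadderSystem 1 R.D where
  ann := R.boseAnn
  cre := R.boseCre
  adjoint := R.inner_boseCre
  ann_cre n m x := by
    have := LinearMap.congr_fun (R.boseAnn_mul_boseCre n m) x
    rw [one_smul]
    split_ifs with h <;> simpa [h] using this
  vac := R.ΩD
  norm_vac := R.norm_Ω
  ann_vac := R.boseAnn_ΩD

/-- The weights $\sqrt 1, \dots, \sqrt k$ multiply up; this is the source of the normalization
constant. -/
theorem boseCre_zero_pow_sD_zero (R : CuntzVacuumRep H) (k : ℕ) (x : R.D) :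
    (R.boseCre 0 ^ k) (R.sD 0 x) = ((Real.sqrt k.factorial : ℝ) : ℂ) • R.sD k x := by
  induction k with
  | zero => simp
  | succ k ih =>
    rw [pow_succ', Module.End.mul_apply, ih, map_smul, boseCre_zero_sD, smul_smul,
      ← Complex.ofReal_mul, ← Real.sqrt_mul (by positivity), Nat.factorial_succ]
    push_cast
    rw [mul_comm]

theorem sD_zero_word (R : CuntzVacuumRep H) (l : List ℕ) :
    R.sD 0 (R.boseLadder.word l) = R.boseLadder.word (l.map Nat.succ) := by
  induction l with
  | nil => exact R.sD_zero_ΩD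
  | cons n l ih =>
    rw [List.map_cons, LadderSystem.word_cons, LadderSystem.word_cons, ← ih]
    exact (R.boseCre_succ_sD n 0 _).symm

/-- `s 0` shifts all modes of a creation word by one, and `s k` is $(k!)^{-1/2}(b_0^*)^k$ `s 0`. -/
theorem sD_mem_span_word (R : CuntzVacuumRep H) (k : ℕ) {x : R.D}
    (hx : x ∈ Submodule.span ℂ (Set.range R.boseLadder.word)) :
    R.sD k x ∈ Submodule.span ℂ (Set.range R.boseLadder.word) := by
  have h0 : R.sD 0 x ∈ Submodule.span ℂ (Set.range R.boseLadder.word) := by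
    refine (Submodule.span_le
      (p := (Submodule.span ℂ (Set.range R.boseLadder.word)).comap (R.sD 0))).2 ?_ hx
    rintro _ ⟨l, rfl⟩
    exact Submodule.subset_span ⟨l.map Nat.succ, (R.sD_zero_word l).symm⟩
  have hk : (R.boseCre 0 ^ k) (R.sD 0 x) ∈ Submodule.span ℂ (Set.range R.boseLadder.word) := by
    induction k with
    | zero => simpa using h0
    | succ k ih =>
      rw [pow_succ', Module.End.mul_apply]
      exact R.boseLadder.cre_mem_span_word 0 ih
  rw [boseCre_zero_pow_sD_zero] at hk
  refine (Submodule.smul_mem_iff _ ?_).1 hk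
  exact Complex.ofReal_ne_zero.2 (Real.sqrt_ne_zero'.2 (by positivity))

theorem span_boseLadder_word (R : CuntzVacuumRep H) :
    Submodule.span ℂ (Set.range R.boseLadder.word) = ⊤ := by
  suffices h : R.D ≤ (Submodule.span ℂ (Set.range R.boseLadder.word)).map R.D.subtype by
    refine eq_top_iff.2 fun x _ => ?_
    obtain ⟨y, hy, hxy⟩ := h x.2
    rwa [← Subtype.ext hxy]
  refine R.D_le_of_prod_s fun L => ?_
  induction L with
  | nil => exact ⟨R.ΩD, Submodule.subset_span ⟨[], rfl⟩, rfl⟩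
  | cons m L ih =>
    obtain ⟨x, hx, hxL⟩ := ih
    refine ⟨R.sD m x, R.sD_mem_span_word m hx, ?_⟩
    simp only [Submodule.subtype_apply] at hxL
    simp [hxL]

end CuntzVacuumRep

/-! ### Uniqueness of unitaries on total families. -/

section Unitary

variable {H K : Type*} [NormedAddCommGroup H] [InnerProductSpace ℂ H]
  [NormedAddCommGroup K] [InnerProductSpace ℂ K]

theorem linearIsometryEquiv_ext_of_dense_span {ι : Type*} {v : ι → H}
    (hv : Dense (Submodule.span ℂ (Set.range v) : Set H)) {V W : H ≃ₗᵢ[ℂ] K}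
    (h : ∀ i, V (v i) = W (v i)) : V = W := by
  refine LinearIsometryEquiv.ext fun x => ?_
  refine congrFun (V.continuous.ext_on hv W.continuous fun y hy => ?_) x
  exact LinearMap.eqOn_span (f := V.toLinearEquiv.toLinearMap) (g := W.toLinearEquiv.toLinearMap)
    (by rintro _ ⟨i, rfl⟩; exact h i) hy

end Unitary

/-! ### The boson Fock representation and its unitary. -/

namespace BoseFock

variable {H : Type*} [NormedAddCommGroup H] [InnerProductSpace ℂ H]

/-- The operators of the Fock representation of bosons on their domain. -/
def ladder (B : BoseFock H) : LadderSystem 1 B.D where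
  ann := B.ann
  cre := B.cre
  adjoint := B.adjoint
  ann_cre n m x := by
    have := LinearMap.congr_fun (B.ann_cre n m) x
    rw [one_smul]
    split_ifs with h <;> simpa [h, sub_eq_iff_eq_add] using this
  vac := B.vac
  norm_vac := B.norm_vac
  ann_vac := B.ann_vac

theorem span_ladder_word (B : BoseFock H) :
    Submodule.span ℂ (Set.range B.ladder.word) = ⊤ := by
  refine eq_top_iff.2 ?_
  rintro x -
  obtain ⟨X, hX, rfl⟩ := B.cyclic x
  suffices h : ∀ v ∈ Submodule.span ℂ (Set.range B.ladder.word),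
      X v ∈ Submodule.span ℂ (Set.range B.ladder.word) from
    h _ (Submodule.subset_span ⟨[], rfl⟩)
  induction hX using Algebra.adjoin_induction with
  | mem X hX =>
    rintro v hv
    rcases hX with ⟨n, rfl⟩ | ⟨n, rfl⟩
    exacts [B.ladder.ann_mem_span_word n hv, B.ladder.cre_mem_span_word n hv]
  | algebraMap c =>
    intro v hv
    rw [Module.algebraMap_end_apply]
    exact Submodule.smul_mem _ c hv
  | add X Y _ _ hX hY => exact fun v hv => Submodule.add_mem _ (hX v hv) (hY v hv)
  | mul X Y _ _ hX hY => exact fun v hv => hX _ (hY v hv)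

end BoseFock

theorem Submodule.span_coe_eq_of_span_eq_top {M ι : Type*} [AddCommGroup M] [Module ℂ M]
    {p : Submodule ℂ M} {v : ι → p} (h : Submodule.span ℂ (Set.range v) = ⊤) :
    Submodule.span ℂ (Set.range fun i => (v i : M)) = p := by
  have : (Set.range fun i => (v i : M)) = p.subtype '' Set.range v := by
    rw [← Set.range_comp]; rfl
  rw [this, Submodule.span_image, h, Submodule.map_top, Submodule.range_subtype]

namespace CuntzVacuumRep

variable {H K : Type*} [NormedAddCommGroup H] [InnerProductSpace ℂ H] [CompleteSpace H]
  [NormedAddCommGroup K] [InnerProductSpace ℂ K]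

theorem span_coe_boseLadder_word (R : CuntzVacuumRep H) :
    Submodule.span ℂ (Set.range fun l => (R.boseLadder.word l : H)) = R.D :=
  Submodule.span_coe_eq_of_span_eq_top R.span_boseLadder_word

/-- Creation words are built from `vac` and `cre`, and graph values are unique, which gives one
direction. Conversely, annihilators act on words with coefficients common to both systems, and
linearity does the rest. -/
theorem isBoseUnitary_iff (R : CuntzVacuumRep H) (B : BoseFock K) (V : H ≃ₗᵢ[ℂ] K) :
    R.IsBoseUnitary B V ↔ ∀ l, V (R.boseLadder.word l) = B.ladder.word l := by
  constructor
  · intro hV l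
    rw [← V.eq_symm_apply]
    induction l with
    | nil => exact V.symm_apply_eq.2 hV.vac.symm |>.symm
    | cons n l ih =>
      have h := hV.cre n (B.ladder.word l)
      rw [← ih] at h
      exact (R.isOperatorGraph_rbsCre n).unique (R.rbsCre_boseCre n _) h
  · intro hV
    have hV' : ∀ l, V.symm (B.ladder.word l) = R.boseLadder.word l := fun l => by
      rw [← hV, V.symm_apply_apply]
    have graph : ∀ (G : H → H → Prop) (T : Module.End ℂ B.D), IsOperatorGraph G →
        (∀ l, G (R.boseLadder.word l) (V.symm (T (B.ladder.word l)))) →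
        ∀ x : B.D, G (V.symm x) (V.symm (T x)) := by
      intro G T hG h x
      let p : Submodule ℂ B.D :=
        { carrier := {x | G (V.symm x) (V.symm (T x))}
          zero_mem' := by simpa using hG.zero
          add_mem' := fun hx hy => by simpa using hG.add hx hy
          smul_mem' := fun c x hx => by simpa using hG.smul c hx }
      have hp : Submodule.span ℂ (Set.range B.ladder.word) ≤ p := by
        refine Submodule.span_le.2 ?_
        rintro _ ⟨l, rfl⟩
        change G _ _
        rw [hV']
        exact h l
      rw [B.span_ladder_word] at hp
      exact hp (Submodule.mem_top (x := x))
    refine ⟨?_, fun n => graph _ _ (R.isOperatorGraph_rbsAnn n) fun l => ?_,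
      fun n => graph _ _ (R.isOperatorGraph_rbsCre n) fun l => ?_, hV []⟩
    · have h : R.D.map V.toLinearEquiv.toLinearMap = B.D := by
        rw [← R.span_coe_boseLadder_word, Submodule.map_span, ← Set.range_comp,
          ← Submodule.span_coe_eq_of_span_eq_top B.span_ladder_word]
        exact congrArg _ (congrArg _ (funext hV))
      rw [← h]
      rfl
    · obtain ⟨c, h, h'⟩ := R.boseLadder.ann_word B.ladder n l
      have : V.symm (B.ladder.ann n (B.ladder.word l)) =
          R.boseLadder.ann n (R.boseLadder.word l) := by
        rw [h, h']
        simp [Finsupp.linearCombination_apply, Finsupp.sum, hV']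
      change R.rbsAnn n _ (V.symm (B.ladder.ann n (B.ladder.word l)))
      rw [this]
      exact R.rbsAnn_boseAnn n _
    · change R.rbsCre n _ (V.symm (B.ladder.cre n (B.ladder.word l)))
      rw [← LadderSystem.word_cons, hV', LadderSystem.word_cons]
      exact R.rbsCre_boseCre n _

theorem existsUnique_isBoseUnitary [CompleteSpace K] (R : CuntzVacuumRep H) (B : BoseFock K) :
    ∃! V : H ≃ₗᵢ[ℂ] K, R.IsBoseUnitary B V := by
  have hR : Dense (Submodule.span ℂ (Set.range fun l => (R.boseLadder.word l : H)) : Set H) := by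
    rw [R.span_coe_boseLadder_word]
    exact R.dense_D
  have hB : Dense (Submodule.span ℂ (Set.range fun l => (B.ladder.word l : K)) : Set K) := by
    rw [Submodule.span_coe_eq_of_span_eq_top B.span_ladder_word]
    exact B.dense_D
  simp only [isBoseUnitary_iff]
  obtain ⟨V, hV⟩ := exists_linearIsometryEquiv_of_gram
    (v := fun l => (R.boseLadder.word l : H)) (w := fun l => (B.ladder.word l : K))
    (R.boseLadder.inner_word B.ladder) hR hB
  exact ⟨V, hV, fun W hW =>
    linearIsometryEquiv_ext_of_dense_span hR fun l => (hW l).trans (hV l).symm⟩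

/-! ### The recursive fermion system -/

theorem ext_t (R : CuntzVacuumRep H) {S T : H →L[ℂ] H}
    (h₀ : ∀ v, S (R.t 0 v) = T (R.t 0 v)) (h₁ : ∀ v, S (R.t 1 v) = T (R.t 1 v)) : S = T := by
  ext x
  have := congrArg (fun A : H →L[ℂ] H => A x) R.sum_mul_star
  simp only [add_apply, mul_apply_eq_comp,
    one_apply_eq_self] at this
  rw [← this, map_add, map_add, h₀, h₁]

theorem rfs_zero_t_zero (R : CuntzVacuumRep H) (v : H) : R.rfs 0 (R.t 0 v) = 0 := by
  simp [rfs, star_t_t]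

theorem rfs_zero_t_one (R : CuntzVacuumRep H) (v : H) : R.rfs 0 (R.t 1 v) = R.t 0 v := by
  simp [rfs, star_t_t]

theorem rfs_succ_t_zero (R : CuntzVacuumRep H) (n : ℕ) (v : H) :
    R.rfs (n + 1) (R.t 0 v) = R.t 0 (R.rfs n v) := by
  simp [rfs, star_t_t]

theorem rfs_succ_t_one (R : CuntzVacuumRep H) (n : ℕ) (v : H) :
    R.rfs (n + 1) (R.t 1 v) = -R.t 1 (R.rfs n v) := by
  simp [rfs, star_t_t]

theorem star_rfs_zero_t_zero (R : CuntzVacuumRep H) (v : H) :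
    star (R.rfs 0) (R.t 0 v) = R.t 1 v := by
  simp [rfs, star_t_t]

theorem star_rfs_zero_t_one (R : CuntzVacuumRep H) (v : H) : star (R.rfs 0) (R.t 1 v) = 0 := by
  simp [rfs, star_t_t]

theorem star_rfs_succ_t_zero (R : CuntzVacuumRep H) (n : ℕ) (v : H) :
    star (R.rfs (n + 1)) (R.t 0 v) = R.t 0 (star (R.rfs n) v) := by
  simp [rfs, star_t_t]

theorem star_rfs_succ_t_one (R : CuntzVacuumRep H) (n : ℕ) (v : H) :
    star (R.rfs (n + 1)) (R.t 1 v) = -R.t 1 (star (R.rfs n) v) := by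
  simp [rfs, star_t_t]

/-- Passing `t 1` costs a sign for each operator of positive mode. Two such signs cancel; a single
one, when exactly one mode is 0, makes the pair anticommute. -/
theorem rfs_mul_star_rfs (R : CuntzVacuumRep H) (n m : ℕ) :
    R.rfs n * star (R.rfs m) = (if n = m then 1 else 0) - star (R.rfs m) * R.rfs n := by
  induction n generalizing m with
  | zero =>
    cases m with
    | zero =>
      apply R.ext_t <;> intro v <;>
        simp [rfs_zero_t_zero, rfs_zero_t_one, star_rfs_zero_t_zero, star_rfs_zero_t_one]
    | succ m =>
      apply R.ext_t <;> intro v <;>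
        simp [rfs_zero_t_zero, rfs_zero_t_one, star_rfs_succ_t_zero, star_rfs_succ_t_one]
  | succ n ih =>
    cases m with
    | zero =>
      apply R.ext_t <;> intro v <;>
        simp [rfs_succ_t_zero, rfs_succ_t_one, star_rfs_zero_t_zero, star_rfs_zero_t_one]
    | succ m =>
      have h : ∀ v, R.rfs n (star (R.rfs m) v) =
          (if n = m then v else 0) - star (R.rfs m) (R.rfs n v) := fun v => by
        have := congrArg (fun A : H →L[ℂ] H => A v) (ih m)
        split_ifs with hnm <;> simpa [hnm] using this
      apply R.ext_t <;> intro v <;>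
        simp only [mul_apply_eq_comp, sub_apply,
          rfs_succ_t_zero, rfs_succ_t_one, star_rfs_succ_t_zero, star_rfs_succ_t_one, map_neg,
          neg_neg, h, Nat.succ_inj] <;>
        split_ifs <;> simp

theorem rfs_Ω (R : CuntzVacuumRep H) (n : ℕ) : R.rfs n R.Ω = 0 := by
  induction n with
  | zero => rw [← R.t_Ω, rfs_zero_t_zero]
  | succ n ih => rw [← R.t_Ω, rfs_succ_t_zero, ih, map_zero]

end CuntzVacuumRep

/-! ### The fermion Fock representation and its unitary. -/

/-- Bounded operators with the anticommutation relations and a vacuum vector. -/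
noncomputable def fermiLadder {H : Type*} [NormedAddCommGroup H] [InnerProductSpace ℂ H]
    [CompleteSpace H] (a : ℕ → H →L[ℂ] H)
    (h : ∀ n m, a n * star (a m) = (if n = m then 1 else 0) - star (a m) * a n)
    (Ω : H) (hΩ : ‖Ω‖ = 1) (haΩ : ∀ n, a n Ω = 0) : LadderSystem (-1) H where
  ann n := (a n).toLinearMap
  cre n := (star (a n)).toLinearMap
  adjoint n x y := ContinuousLinearMap.adjoint_inner_left _ _ _
  ann_cre n m x := by
    have := congrArg (fun A : H →L[ℂ] H => A x) (h n m)
    split_ifs with hnm <;> simpa [hnm, sub_eq_add_neg] using this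
  vac := Ω
  norm_vac := hΩ
  ann_vac := haΩ

/-- The Fock representation of fermions. -/
noncomputable def FermiFock.ladder {H : Type*} [NormedAddCommGroup H] [InnerProductSpace ℂ H]
    [CompleteSpace H] (F : FermiFock H) : LadderSystem (-1) H :=
  fermiLadder F.ann (fun n m => eq_sub_of_add_eq (F.ann_cre n m)) F.vac F.norm_vac F.ann_vac

theorem FermiFock.dense_span_ladder_word {H : Type*} [NormedAddCommGroup H]
    [InnerProductSpace ℂ H] [CompleteSpace H] (F : FermiFock H) :
    Dense (Submodule.span ℂ (Set.range F.ladder.word) : Set H) := by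
  refine F.cyclic.mono ?_
  rintro _ ⟨X, hX, rfl⟩
  suffices h : ∀ v ∈ Submodule.span ℂ (Set.range F.ladder.word),
      X v ∈ Submodule.span ℂ (Set.range F.ladder.word) from
    h _ (Submodule.subset_span ⟨[], rfl⟩)
  rw [← StarSubalgebra.mem_toSubalgebra, StarAlgebra.adjoin_toSubalgebra] at hX
  induction hX using Algebra.adjoin_induction with
  | mem X hX =>
    rintro v hv
    rcases hX with ⟨i, rfl⟩ | ⟨i, hi⟩
    · exact F.ladder.ann_mem_span_word i hv
    · rw [← star_star X, ← hi]
      exact F.ladder.cre_mem_span_word i hv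
  | algebraMap c =>
    intro v hv
    rw [Algebra.algebraMap_eq_smul_one]
    exact Submodule.smul_mem _ c hv
  | add X Y _ _ hX hY => exact fun v hv => Submodule.add_mem _ (hX v hv) (hY v hv)
  | mul X Y _ _ hX hY => exact fun v hv => hX _ (hY v hv)

namespace CuntzVacuumRep

variable {H K : Type*} [NormedAddCommGroup H] [InnerProductSpace ℂ H] [CompleteSpace H]
  [NormedAddCommGroup K] [InnerProductSpace ℂ K] [CompleteSpace K]

/-- The recursive fermion system with the vacuum `Ω`. -/
noncomputable def fermiLadder (R : CuntzVacuumRep H) : LadderSystem (-1) H :=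
  _root_.fermiLadder R.rfs R.rfs_mul_star_rfs R.Ω R.norm_Ω R.rfs_Ω

theorem t_zero_fermiLadder_word (R : CuntzVacuumRep H) (l : List ℕ) :
    R.t 0 (R.fermiLadder.word l) = R.fermiLadder.word (l.map Nat.succ) := by
  induction l with
  | nil => exact R.t_Ω
  | cons n l ih =>
    rw [List.map_cons, LadderSystem.word_cons, LadderSystem.word_cons, ← ih]
    exact (R.star_rfs_succ_t_zero n _).symm

theorem t_one_fermiLadder_word (R : CuntzVacuumRep H) (l : List ℕ) :
    R.t 1 (R.fermiLadder.word l) = R.fermiLadder.word (0 :: l.map Nat.succ) := by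
  rw [LadderSystem.word_cons, ← t_zero_fermiLadder_word]
  exact (R.star_rfs_zero_t_zero _).symm

theorem dense_span_fermiLadder_word (R : CuntzVacuumRep H) :
    Dense (Submodule.span ℂ (Set.range R.fermiLadder.word) : Set H) := by
  refine R.dense_D.mono (R.D_le (Submodule.subset_span ⟨[], rfl⟩) fun i v hv => ?_)
  refine (Submodule.span_le (p := (Submodule.span ℂ
    (Set.range R.fermiLadder.word)).comap (R.t i).toLinearMap)).2 ?_ hv
  rintro _ ⟨l, rfl⟩
  match i with
  | 0 => exact Submodule.subset_span ⟨_, (R.t_zero_fermiLadder_word l).symm⟩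
  | 1 => exact Submodule.subset_span ⟨_, (R.t_one_fermiLadder_word l).symm⟩

theorem isFermiUnitary_iff (R : CuntzVacuumRep H) (F : FermiFock K) (V : H ≃ₗᵢ[ℂ] K) :
    R.IsFermiUnitary F V ↔ ∀ l, V (R.fermiLadder.word l) = F.ladder.word l := by
  constructor
  · intro hV l
    induction l with
    | nil => exact hV.vac
    | cons n l ih =>
      rw [LadderSystem.word_cons, LadderSystem.word_cons, ← ih]
      exact map_star_apply_of_intertwines V (fun x => by simpa using hV.ann n (V x)) _
  · intro hV
    refine ⟨fun n y => ?_, hV []⟩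
    -- Matching words gives the intertwining of creators on a dense subspace; continuity extends it
    -- and adjoints give the annihilators.
    have h : ∀ x, V (star (R.rfs n) x) = star (F.ann n) (V x) := by
      refine congrFun (Continuous.ext_on R.dense_span_fermiLadder_word (by fun_prop)
        (by fun_prop) fun x hx => ?_)
      refine LinearMap.eqOn_span
        (f := V.toLinearEquiv.toLinearMap ∘ₗ (star (R.rfs n)).toLinearMap)
        (g := (star (F.ann n)).toLinearMap ∘ₗ V.toLinearEquiv.toLinearMap) ?_ hx
      rintro _ ⟨l, rfl⟩
      change V (star (R.rfs n) (R.fermiLadder.word l)) = star (F.ann n) (V (R.fermiLadder.word l))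
      rw [hV]
      exact hV (n :: l)
    simpa using map_star_apply_of_intertwines V h (V.symm y)

theorem existsUnique_isFermiUnitary (R : CuntzVacuumRep H) (F : FermiFock K) :
    ∃! V : H ≃ₗᵢ[ℂ] K, R.IsFermiUnitary F V := by
  simp only [isFermiUnitary_iff]
  obtain ⟨V, hV⟩ := exists_linearIsometryEquiv_of_gram (R.fermiLadder.inner_word F.ladder)
    R.dense_span_fermiLadder_word F.dense_span_ladder_word
  exact ⟨V, hV, fun W hW => linearIsometryEquiv_ext_of_dense_span R.dense_span_fermiLadder_word
    fun l => (hW l).trans (hV l).symm⟩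

end CuntzVacuumRep

/-! ### Creation words without repeated modes. -/

namespace LadderSystem

variable {q : ℂ} {E : Type*} [NormedAddCommGroup E] [InnerProductSpace ℂ E]

theorem ann_word_of_notMem (S : LadderSystem q E) {n : ℕ} {l : List ℕ} (h : n ∉ l) :
    S.ann n (S.word l) = 0 := by
  induction l with
  | nil => exact S.ann_vac n
  | cons m l ih =>
    rw [List.mem_cons, not_or] at h
    rw [word_cons, S.ann_cre, if_neg h.1, ih h.2, map_zero, smul_zero, add_zero]

theorem ann_word_cons_self (S : LadderSystem q E) {n : ℕ} {l : List ℕ} (h : n ∉ l) :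
    S.ann n (S.word (n :: l)) = S.word l := by
  rw [word_cons, S.ann_cre, if_pos rfl, S.ann_word_of_notMem h, map_zero, smul_zero, add_zero]

theorem norm_word (S : LadderSystem q E) {l : List ℕ} (h : l.Nodup) : ‖S.word l‖ = 1 := by
  induction l with
  | nil => exact S.norm_vac
  | cons n l ih =>
    rw [List.nodup_cons] at h
    have : inner ℂ (S.word (n :: l)) (S.word (n :: l)) = inner ℂ (S.word l) (S.word l) := by
      conv_lhs => rw [word_cons, S.adjoint, ← word_cons, S.ann_word_cons_self h.1]
    rw [@norm_eq_sqrt_re_inner ℂ, this, ← @norm_eq_sqrt_re_inner ℂ, ih h.2]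

theorem word_ne_zero (S : LadderSystem q E) {l : List ℕ} (h : l.Nodup) : S.word l ≠ 0 :=
  norm_ne_zero_iff.1 (by simp [S.norm_word h])

/-- An ordered list of modes is determined by its creation word. -/
theorem word_injOn (S : LadderSystem q E) :
    Set.InjOn S.word {l | l.Pairwise (· < ·)} := by
  intro l hl l' hl' h
  change l.Pairwise _ at hl
  change l'.Pairwise _ at hl'
  induction l generalizing l' with
  | nil =>
    cases l' with
    | nil => rfl
    | cons n l' =>
      rw [List.pairwise_cons] at hl'
      have := congrArg (S.ann n) h
      rw [S.ann_word_cons_self fun hn => (hl'.1 n hn).false, word_nil, S.ann_vac] at this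
      exact absurd this.symm (S.word_ne_zero hl'.2.nodup)
  | cons n l ih =>
    rw [List.pairwise_cons] at hl
    have hn : n ∉ l := fun hn => (hl.1 n hn).false
    cases l' with
    | nil =>
      have := congrArg (S.ann n) h
      rw [S.ann_word_cons_self hn, word_nil, S.ann_vac] at this
      exact absurd this (S.word_ne_zero hl.2.nodup)
    | cons m l' =>
      rw [List.pairwise_cons] at hl'
      have hm : m ∉ l' := fun hm => (hl'.1 m hm).false
      -- The annihilator of the smaller leading mode kills one word and strips the other to a
      -- nonzero word.
      rcases lt_trichotomy n m with hnm | rfl | hnm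
      · have := congrArg (S.ann n) h
        rw [S.ann_word_cons_self hn, S.ann_word_of_notMem] at this
        · exact absurd this (S.word_ne_zero hl.2.nodup)
        · rw [List.mem_cons, not_or]
          exact ⟨hnm.ne, fun hn => (hnm.trans (hl'.1 n hn)).false⟩
      · have := congrArg (S.ann n) h
        rw [S.ann_word_cons_self hn, S.ann_word_cons_self hm] at this
        rw [ih this hl.2 hl'.2]
      · have := congrArg (S.ann m) h
        rw [S.ann_word_cons_self hm, S.ann_word_of_notMem] at this
        · exact absurd this.symm (S.word_ne_zero hl'.2.nodup)
        · rw [List.mem_cons, not_or]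
          exact ⟨hnm.ne, fun hn => (hnm.trans (hl.1 m hn)).false⟩

end LadderSystem

/-! ### Boson occupations and ordered lists of fermion modes -/

/-- Pairs `(n, k)` of a mode and its multiplicity, with increasing modes and `k ≥ 1`. -/
def IsOccupation (p : List (ℕ × ℕ)) : Prop :=
  p.Pairwise (fun x y => x.1 < y.1) ∧ ∀ x ∈ p, 1 ≤ x.2

/-- The fermion modes of the blocks, displaced by `c`. -/
def blockModes : ℕ → List (ℕ × ℕ) → List ℕ
  | _, [] => []
  | c, (n, k) :: p => (List.range k).map (n + c + ·) ++ blockModes (c + k) p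

theorem isOccupation_cons {x : ℕ × ℕ} {p : List (ℕ × ℕ)} :
    IsOccupation (x :: p) ↔ (1 ≤ x.2 ∧ ∀ y ∈ p, x.1 < y.1) ∧ IsOccupation p := by
  simp only [IsOccupation, List.pairwise_cons, List.forall_mem_cons]
  tauto

/-- Peeling off the first fermion mode lowers the first multiplicity and raises the displacement by
one; the inductions below run on this. -/
theorem blockModes_succ (c n k : ℕ) (p : List (ℕ × ℕ)) :
    blockModes c ((n, k + 1) :: p) = (n + c) :: blockModes (c + 1) ((n, k) :: p) := by
  simp only [blockModes, List.range_succ_eq_map, List.map_cons, List.map_map, List.cons_append,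
    add_zero]
  congr 2
  · exact List.map_congr_left fun i _ => by simp only [Function.comp_apply]; omega
  · congr 1; omega

theorem blockModes_zero (c n : ℕ) (p : List (ℕ × ℕ)) :
    blockModes c ((n, 0) :: p) = blockModes c p := rfl

theorem le_of_mem_blockModes {d : ℕ} {p : List (ℕ × ℕ)} (h : ∀ x ∈ p, d ≤ x.1) (c j : ℕ)
    (hj : j ∈ blockModes c p) : d + c ≤ j := by
  induction p generalizing c with
  | nil => simp [blockModes] at hj
  | cons x p ih =>
    obtain ⟨n, k⟩ := x
    rw [List.forall_mem_cons] at h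
    rw [blockModes, List.mem_append, List.mem_map] at hj
    rcases hj with ⟨i, -, rfl⟩ | hj
    · have := h.1; simp only at this; omega
    · have := ih h.2 _ hj; omega

theorem pairwise_blockModes {p : List (ℕ × ℕ)} (hp : IsOccupation p) (c : ℕ) :
    (blockModes c p).Pairwise (· < ·) := by
  induction p generalizing c with
  | nil => simp [blockModes]
  | cons x p ih =>
    obtain ⟨n, k⟩ := x
    rw [isOccupation_cons] at hp
    rw [blockModes, List.pairwise_append, List.pairwise_map]
    refine ⟨List.pairwise_lt_range.imp (by omega), ih hp.2 _, ?_⟩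
    simp only [List.mem_map, List.mem_range]
    rintro _ ⟨i, hi, rfl⟩ b hb
    have := le_of_mem_blockModes (d := n + 1) hp.1.2 _ _ hb
    omega

theorem exists_blockModes_eq {l : List ℕ} (hl : l.Pairwise (· < ·)) (c : ℕ)
    (hc : ∀ j ∈ l, c ≤ j) : ∃ p, IsOccupation p ∧ blockModes c p = l := by
  induction l generalizing c with
  | nil => exact ⟨[], by simp [IsOccupation], rfl⟩
  | cons j l ih =>
    rw [List.pairwise_cons] at hl
    rw [List.forall_mem_cons] at hc
    obtain ⟨p, hp, rfl⟩ := ih hl.2 (c + 1) fun i hi => by have := hl.1 i hi; omega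
    match p, hp with
    | [], _ =>
      refine ⟨[(j - c, 1)], by simp [IsOccupation], ?_⟩
      rw [blockModes_succ, blockModes_zero, Nat.sub_add_cancel hc.1]
    | (n, k) :: p, hp =>
      have hp' := isOccupation_cons.1 hp
      obtain ⟨k, rfl⟩ : ∃ i, k = i + 1 := ⟨k - 1, by have := hp'.1.1; simp only at this; omega⟩
      have hn : j < n + (c + 1) := hl.1 _ (by rw [blockModes_succ]; exact List.mem_cons_self)
      -- Equality means that the next block starts at `j + 1`, so `j` lengthens it; otherwise `j`
      -- forms a block of its own.
      rcases eq_or_ne n (j - c) with rfl | hne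
      · refine ⟨(j - c, k + 2) :: p, isOccupation_cons.2 ⟨⟨by simp, hp'.1.2⟩, hp'.2⟩, ?_⟩
        rw [blockModes_succ, Nat.sub_add_cancel hc.1]
      · refine ⟨(j - c, 1) :: (n, k + 1) :: p, isOccupation_cons.2 ⟨⟨le_rfl, ?_⟩, hp⟩, ?_⟩
        · rw [List.forall_mem_cons]
          have : j - c < n := by omega
          exact ⟨this, fun y hy => this.trans (hp'.1.2 y hy)⟩
        · rw [blockModes_succ, blockModes_zero, Nat.sub_add_cancel hc.1]

theorem blockModes_injOn (c : ℕ) : Set.InjOn (blockModes c) {p | IsOccupation p} := by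
  intro p hp p' hp' h
  change IsOccupation p at hp
  change IsOccupation p' at hp'
  obtain ⟨l, hl⟩ : ∃ l, blockModes c p = l := ⟨_, rfl⟩
  rw [hl] at h
  induction l generalizing c p p' with
  | nil =>
    have nil : ∀ p, IsOccupation p → blockModes c p = [] → p = [] := by
      rintro (_ | ⟨⟨n, _ | k⟩, p⟩) hp h
      · rfl
      · simp [isOccupation_cons] at hp
      · simp [blockModes_succ] at h
    rw [nil p hp hl, nil p' hp' h.symm]
  | cons j l ih =>
    have cons : ∀ p, IsOccupation p → blockModes c p = j :: l → ∃ n k q, p = (n, k + 1) :: q ∧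
        n + c = j ∧ blockModes (c + 1) ((n, k) :: q) = l := by
      rintro (_ | ⟨⟨n, _ | k⟩, p⟩) hp h
      · simp [blockModes] at h
      · simp [isOccupation_cons] at hp
      · rw [blockModes_succ, List.cons.injEq] at h
        exact ⟨n, k, p, rfl, h⟩
    obtain ⟨n, k, q, rfl, hn, hq⟩ := cons p hp hl
    obtain ⟨n', k', q', rfl, hn', hq'⟩ := cons p' hp' h.symm
    obtain rfl : n = n' := by omega
    have o := isOccupation_cons.1 hp
    have o' := isOccupation_cons.1 hp'
    have pred : ∀ {k q}, (∀ y ∈ q, n < y.1) → IsOccupation q → IsOccupation ((n, k + 1) :: q) :=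
      fun h hq => isOccupation_cons.2 ⟨⟨Nat.succ_pos _, h⟩, hq⟩
    -- A block of length 0 contributes nothing and is dropped, leaving an occupation. If only one
    -- side drops it, the induction hypothesis puts mode `n` among modes that exceed `n`.
    rcases k with _ | k <;> rcases k' with _ | k'
    · rw [ih (c + 1) o.2 o'.2 hq'.symm hq]
    · have := ih (c + 1) o.2 (pred o'.1.2 o'.2) hq'.symm hq
      have := o.1.2 (n, k' + 1) (by rw [this]; exact List.mem_cons_self)
      exact absurd this (lt_irrefl _)
    · have := ih (c + 1) (pred o.1.2 o.2) o'.2 hq'.symm hq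
      have := o'.1.2 (n, k + 1) (by rw [← this]; exact List.mem_cons_self)
      exact absurd this (lt_irrefl _)
    · have := ih (c + 1) (pred o.1.2 o.2)
        (pred o'.1.2 o'.2) hq'.symm hq
      simp only [List.cons.injEq, Prod.mk.injEq, true_and] at this
      rw [this.1, this.2]

/-! ### Boson and fermion creation words as the same vectors of `H`. -/

/-- The boson modes of an occupation, with multiplicity. -/
def bosonModes (p : List (ℕ × ℕ)) : List ℕ := p.flatMap fun x => List.replicate x.2 x.1

/-- The squared norm of a boson creation monomial applied to the vacuum. -/
def occupationFactor (p : List (ℕ × ℕ)) : ℝ := (p.map fun x => (x.2.factorial : ℝ)).prod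

theorem occupationFactor_pos (p : List (ℕ × ℕ)) : 0 < occupationFactor p :=
  List.prod_pos (by simp only [List.mem_map]; rintro _ ⟨x, -, rfl⟩; positivity)

theorem LadderSystem.word_append {q : ℂ} {E : Type*} [NormedAddCommGroup E]
    [InnerProductSpace ℂ E] (S : LadderSystem q E) (l l' : List ℕ) :
    S.word (l ++ l') = (l.map S.cre).prod (S.word l') := by
  simp [LadderSystem.word]

namespace CuntzVacuumRep

variable {H : Type*} [NormedAddCommGroup H] [InnerProductSpace ℂ H] [CompleteSpace H]

theorem boseCre_pow_sD_zero_pow (R : CuntzVacuumRep H) (n k : ℕ) (x : R.D) :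
    (R.boseCre n ^ k) ((R.sD 0 ^ n) x) = (R.sD 0 ^ n) ((R.boseCre 0 ^ k) x) := by
  induction k generalizing x with
  | zero => rfl
  | succ k ih =>
    have : R.boseCre n ((R.sD 0 ^ n) x) = (R.sD 0 ^ n) (R.boseCre 0 x) := by
      clear ih
      induction n with
      | zero => rfl
      | succ n ih => simp only [pow_succ', Module.End.mul_apply, boseCre_succ_sD, ih]
    rw [pow_succ, Module.End.mul_apply, this, ih, pow_succ, Module.End.mul_apply]

/-- The rightmost creator acts first, so each one meets only letters `t 0` to the left of its
position and no sign arises. -/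
theorem prod_fermiLadder_cre_t_zero_pow (R : CuntzVacuumRep H) (n k : ℕ) (v : H) :
    ((List.range k).map (n + ·) |>.map R.fermiLadder.cre).prod ((R.t 0 ^ (n + k)) v) =
      (R.t 0 ^ n) ((R.t 1 ^ k) v) := by
  have shift : ∀ i d w, R.fermiLadder.cre (i + d) ((R.t 0 ^ d) w) =
      (R.t 0 ^ d) (R.fermiLadder.cre i w) := by
    intro i d w
    induction d with
    | zero => rfl
    | succ d ih =>
      rw [pow_succ', mul_apply_eq_comp, mul_apply_eq_comp, ← ih]
      exact R.star_rfs_succ_t_zero _ _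
  induction k generalizing n with
  | zero => rfl
  | succ k ih =>
    have hl : (List.range (k + 1)).map (n + ·) = n :: (List.range k).map (n + 1 + ·) := by
      rw [List.range_succ_eq_map, List.map_cons, List.map_map, add_zero]
      exact congrArg _ (List.map_congr_left fun i _ => by simp only [Function.comp_apply]; omega)
    rw [hl, List.map_cons, List.prod_cons, Module.End.mul_apply, ← add_assoc, add_right_comm, ih,
      pow_succ, mul_apply_eq_comp]
    have h := shift 0 n (R.t 0 ((R.t 1 ^ k) v))
    rw [zero_add] at h
    rw [h]
    refine congrArg _ ?_
    rw [pow_succ', mul_apply_eq_comp]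
    exact R.star_rfs_zero_t_zero _

/-- Modes at least `d` leave `d` leading letters `t 0`, and displacing the fermion modes by `c`
prepends `c` more. The common remainder `x` is what the next block acts on. -/
theorem exists_word_bosonModes (R : CuntzVacuumRep H) {p : List (ℕ × ℕ)} (hp : IsOccupation p)
    (d : ℕ) (hd : ∀ x ∈ p, d ≤ x.1) :
    ∃ x : R.D, R.boseLadder.word (bosonModes p) = (R.sD 0 ^ d) x ∧
      ∀ c, ((Real.sqrt (occupationFactor p) : ℝ) : ℂ) • R.fermiLadder.word (blockModes c p) =
        (R.t 0 ^ (c + d)) (x : H) := by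
  have coe_pow : ∀ n (x : R.D), ((R.sD 0 ^ n) x : H) = (R.t 0 ^ n) (x : H) := by
    intro n x
    induction n with
    | zero => rfl
    | succ n ih =>
      rw [pow_succ', pow_succ', Module.End.mul_apply, coe_sD, ih, s_zero_apply, mul_apply_eq_comp]
  induction p generalizing d with
  | nil =>
    refine ⟨R.ΩD, ?_, fun c => ?_⟩
    · induction d with
      | zero => rfl
      | succ d ih =>
        rw [pow_succ, Module.End.mul_apply, sD_zero_ΩD]
        exact ih (by simp)
    · have : ∀ d, (R.t 0 ^ d) R.Ω = R.Ω := fun d => by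
        induction d with
        | zero => rfl
        | succ d ih => rw [pow_succ, mul_apply_eq_comp, R.t_Ω, ih]
      simp only [occupationFactor, List.map_nil, List.prod_nil, Real.sqrt_one, Complex.ofReal_one,
        one_smul]
      exact (this _).symm
  | cons y p ih =>
    obtain ⟨n, k⟩ := y
    rw [isOccupation_cons] at hp
    rw [List.forall_mem_cons] at hd
    obtain ⟨x, hx, hxc⟩ := ih hp.2 (n + 1) hp.1.2
    have hdn : d ≤ n := hd.1
    have hfac : occupationFactor ((n, k) :: p) = k.factorial * occupationFactor p := rfl
    -- The tail has modes at least `n + 1`; of its leading letters `t 0`, one is absorbed into `s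
    -- k`, and `n` stand before it, `d` of which are split off.
    refine ⟨(R.sD 0 ^ (n - d)) (((Real.sqrt k.factorial : ℝ) : ℂ) • R.sD k x), ?_, fun c => ?_⟩
    · have : bosonModes ((n, k) :: p) = List.replicate k n ++ bosonModes p := rfl
      rw [this, LadderSystem.word_append, hx, List.map_replicate, List.prod_replicate, pow_succ,
        Module.End.mul_apply]
      change (R.boseCre n ^ k) _ = _
      rw [boseCre_pow_sD_zero_pow, boseCre_zero_pow_sD_zero, ← Module.End.mul_apply, ← pow_add,
        Nat.add_sub_cancel' hdn]
    · rw [hfac, Real.sqrt_mul (by positivity), Complex.ofReal_mul, mul_smul, blockModes,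
        LadderSystem.word_append, ← map_smul, hxc, coe_pow, ← mul_apply_eq_comp, ← pow_add,
        show c + k + (n + 1) = (n + c + k) + 1 by omega, pow_succ, mul_apply_eq_comp,
        prod_fermiLadder_cre_t_zero_pow, show c + d + (n - d) = n + c by omega,
        Submodule.coe_smul, map_smul, coe_sD]
      rfl

/-- The boson creation words are multiples of the ordered fermion creation words. -/
theorem word_bosonModes (R : CuntzVacuumRep H) {p : List (ℕ × ℕ)} (hp : IsOccupation p) :
    (R.boseLadder.word (bosonModes p) : H) =
      ((Real.sqrt (occupationFactor p) : ℝ) : ℂ) • R.fermiLadder.word (blockModes 0 p) := by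
  obtain ⟨x, hx, hxc⟩ := R.exists_word_bosonModes hp 0 (by simp)
  rw [hx, hxc]
  rfl

theorem word_bosonModes_injOn (R : CuntzVacuumRep H) :
    Set.InjOn (fun p => R.boseLadder.word (bosonModes p)) {p | IsOccupation p} := by
  intro p hp p' hp' h
  have h' := congrArg (Subtype.val) h
  simp only [R.word_bosonModes hp, R.word_bosonModes hp'] at h'
  -- Ordered fermion words are unit vectors, so norms identify the two scalars, which then cancel.
  have hn := congrArg norm h'
  rw [norm_smul, norm_smul, R.fermiLadder.norm_word (pairwise_blockModes hp 0).nodup,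
    R.fermiLadder.norm_word (pairwise_blockModes hp' 0).nodup, mul_one, mul_one,
    Complex.norm_of_nonneg (Real.sqrt_nonneg _), Complex.norm_of_nonneg (Real.sqrt_nonneg _)] at hn
  have h0 : ((Real.sqrt (occupationFactor p') : ℝ) : ℂ) ≠ 0 :=
    Complex.ofReal_ne_zero.2 (Real.sqrt_ne_zero'.2 (occupationFactor_pos p'))
  rw [hn] at h'
  exact blockModes_injOn 0 hp hp' (R.fermiLadder.word_injOn (pairwise_blockModes hp 0)
    (pairwise_blockModes hp' 0) (smul_right_injective H h0 h'))

end CuntzVacuumRep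

/-! ### Monomials indexed by occupations and by increasing lists. -/

namespace BoseFock

variable {H : Type*} [NormedAddCommGroup H] [InnerProductSpace ℂ H]

/-- The boson creation monomial of an occupation. -/
def occupationMonomial (B : BoseFock H) (p : List (ℕ × ℕ)) : Module.End ℂ B.D :=
  (p.map fun x => B.cre x.1 ^ x.2).prod

theorem monomial_eq (B : BoseFock H) {m : ℕ} (n k : Fin m → ℕ) :
    B.monomial n k = B.occupationMonomial (List.ofFn fun i => (n i, k i)) := by
  rw [monomial, occupationMonomial, List.map_ofFn]
  rfl

theorem occupationMonomial_vac (B : BoseFock H) (p : List (ℕ × ℕ)) :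
    B.occupationMonomial p B.vac = B.ladder.word (bosonModes p) := by
  induction p with
  | nil => rfl
  | cons x p ih =>
    have : bosonModes (x :: p) = List.replicate x.2 x.1 ++ bosonModes p := rfl
    rw [this, LadderSystem.word_append, ← ih, List.map_replicate, List.prod_replicate,
      occupationMonomial, List.map_cons, List.prod_cons]
    rfl

end BoseFock

theorem isOccupation_ofFn {m : ℕ} {n k : Fin m → ℕ} (hn : StrictMono n) (hk : ∀ i, 1 ≤ k i) :
    IsOccupation (List.ofFn fun i => (n i, k i)) := by
  refine ⟨List.pairwise_ofFn.2 fun i j h => hn h, ?_⟩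
  simp only [List.mem_ofFn]
  rintro _ ⟨i, rfl⟩
  exact hk i

theorem IsOccupation.exists_ofFn {p : List (ℕ × ℕ)} (hp : IsOccupation p) :
    ∃ (m : ℕ) (n k : Fin m → ℕ), StrictMono n ∧ (∀ i, 1 ≤ k i) ∧
      p = List.ofFn fun i => (n i, k i) := by
  refine ⟨p.length, fun i => (p.get i).1, fun i => (p.get i).2, fun i j h => ?_,
    fun i => hp.2 _ (List.get_mem p i), (List.ofFn_get p).symm⟩
  exact List.pairwise_iff_get.1 hp.1 i j h

theorem BoseFock.creationMonomials_eq {H : Type*} [NormedAddCommGroup H] [InnerProductSpace ℂ H]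
    (B : BoseFock H) : B.creationMonomials = B.occupationMonomial '' {p | IsOccupation p} := by
  ext X
  constructor
  · rintro ⟨m, n, k, hn, hk, rfl⟩
    exact ⟨_, isOccupation_ofFn hn hk, (B.monomial_eq n k).symm⟩
  · rintro ⟨p, hp, rfl⟩
    obtain ⟨m, n, k, hn, hk, rfl⟩ := hp.exists_ofFn
    exact ⟨m, n, k, hn, hk, (B.monomial_eq n k).symm⟩

theorem Fin.sum_Iio_succ {m : ℕ} (k : Fin (m + 1) → ℕ) (i : Fin m) :
    ∑ j ∈ Finset.Iio i.succ, k j = k 0 + ∑ j ∈ Finset.Iio i, k j.succ := by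
  have h : ∀ {m : ℕ} (k : Fin m → ℕ) (i : Fin m),
      ∑ j ∈ Finset.Iio i, k j = ∑ j, if j < i then k j else 0 := fun k i => by
    rw [← Finset.sum_filter]
    congr 1
    ext; simp
  rw [h, h, Fin.sum_univ_succ]
  simp

namespace FermiFock

variable {H : Type*} [NormedAddCommGroup H] [InnerProductSpace ℂ H] [CompleteSpace H]

theorem prod_cre_vac (F : FermiFock H) (l : List ℕ) :
    (l.map F.cre).prod F.vac = F.ladder.word l := by
  induction l with
  | nil => rfl
  | cons n l ih =>
    rw [LadderSystem.word_cons, ← ih, List.map_cons, List.prod_cons]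
    rfl

theorem prod_cre_injOn (F : FermiFock H) :
    Set.InjOn (fun l : List ℕ => (l.map F.cre).prod) {l | l.Pairwise (· < ·)} := by
  intro l hl l' hl' h
  refine F.ladder.word_injOn hl hl' ?_
  rw [← prod_cre_vac, ← prod_cre_vac]
  exact congrArg (fun A : H →L[ℂ] H => A F.vac) h

theorem creationMonomials_eq (F : FermiFock H) :
    F.creationMonomials = (fun l : List ℕ => (l.map F.cre).prod) '' {l | l.Pairwise (· < ·)} := by
  ext Y
  constructor
  · rintro ⟨m, j, hj, rfl⟩
    refine ⟨List.ofFn j, List.pairwise_ofFn.2 fun i j h => hj h, ?_⟩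
    simp only [List.map_ofFn]
    rfl
  · rintro ⟨l, hl, rfl⟩
    refine ⟨l.length, l.get, fun i j h => List.pairwise_iff_get.1 hl i j h, ?_⟩
    conv_lhs => rw [← List.ofFn_get l]
    simp only [List.map_ofFn]
    rfl

theorem blocks_eq (F : FermiFock H) {m : ℕ} (n k : Fin m → ℕ) :
    F.blocks n k = ((blockModes 0 (List.ofFn fun i => (n i, k i))).map F.cre).prod := by
  -- A general displacement is needed because the first block shifts all later ones.
  suffices h : ∀ c, (List.ofFn fun i => F.A (n i + c + ∑ j ∈ Finset.Iio i, k j) (k i)).prod =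
      ((blockModes c (List.ofFn fun i => (n i, k i))).map F.cre).prod from h 0
  induction m with
  | zero => intro c; simp [blockModes]
  | succ m ih =>
    intro c
    have := ih (fun i => n i.succ) (fun i => k i.succ) (c + k 0)
    rw [List.ofFn_succ, List.ofFn_succ, blockModes, List.map_append, List.prod_append, ← this,
      List.prod_cons]
    congr 1
    · simp only [A, List.map_map, ← bot_eq_zero, Finset.Iio_bot, Finset.sum_empty]
      rfl
    · congr 2
      ext1 i
      rw [Fin.sum_Iio_succ]
      congr 1
      omega

end FermiFock

theorem corollary1p1 {H HB HF : Type*}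
    [NormedAddCommGroup H] [InnerProductSpace ℂ H] [CompleteSpace H]
    [NormedAddCommGroup HB] [InnerProductSpace ℂ HB] [CompleteSpace HB]
    [NormedAddCommGroup HF] [InnerProductSpace ℂ HF] [CompleteSpace HF]
    (R : CuntzVacuumRep H) (B : BoseFock HB) (F : FermiFock HF) :
    (∃! VB : H ≃ₗᵢ[ℂ] HB, R.IsBoseUnitary B VB) ∧
    (∃! VF : H ≃ₗᵢ[ℂ] HF, R.IsFermiUnitary F VF) ∧
    ∃ Φ : Module.End ℂ B.D → (HF →L[ℂ] HF),
      Set.BijOn Φ B.creationMonomials F.creationMonomials ∧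
      (∀ (m : ℕ) (n k : Fin m → ℕ), StrictMono n → (∀ i, 1 ≤ k i) →
        Φ (B.monomial n k) = F.blocks n k) ∧
      ∀ (VB : H ≃ₗᵢ[ℂ] HB) (VF : H ≃ₗᵢ[ℂ] HF),
        R.IsBoseUnitary B VB → R.IsFermiUnitary F VF →
        ∀ U : HB ≃ₗᵢ[ℂ] HF, U = VB.symm.trans VF →
          U (B.vac : HB) = F.vac ∧
          ∀ (m : ℕ) (n k : Fin m → ℕ), StrictMono n → (∀ i, 1 ≤ k i) →
            U (B.monomial n k B.vac : HB) =
              ((Real.sqrt (∏ i, ((k i).factorial : ℝ)) : ℝ) : ℂ) •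
                Φ (B.monomial n k) F.vac := by
  have hB := R.existsUnique_isBoseUnitary B
  -- `Φ` is a function of operators, so an operator must determine its exponents; its value on the
  -- vacuum, carried back to `H`, does.
  have monomial_inj : Set.InjOn B.occupationMonomial {p | IsOccupation p} := by
    obtain ⟨V, hV, -⟩ := hB
    rw [R.isBoseUnitary_iff] at hV
    intro p hp p' hp' h
    refine R.word_bosonModes_injOn hp hp' (Subtype.ext (V.injective ?_))
    rw [hV, hV, ← B.occupationMonomial_vac, ← B.occupationMonomial_vac, h]
  let Φ : Module.End ℂ B.D → (HF →L[ℂ] HF) := fun X =>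
    ((blockModes 0 (Function.invFunOn B.occupationMonomial {p | IsOccupation p} X)).map F.cre).prod
  have hΦ : ∀ p, IsOccupation p →
      Φ (B.occupationMonomial p) = ((blockModes 0 p).map F.cre).prod := fun p hp => by
    simp only [Φ]
    rw [monomial_inj.leftInvOn_invFunOn hp]
  have hΦ' : ∀ (m : ℕ) (n k : Fin m → ℕ), StrictMono n → (∀ i, 1 ≤ k i) →
      Φ (B.monomial n k) = F.blocks n k := fun m n k hn hk => by
    rw [B.monomial_eq, hΦ _ (isOccupation_ofFn hn hk), F.blocks_eq]
  refine ⟨hB, R.existsUnique_isFermiUnitary F, Φ, ⟨?_, ?_, ?_⟩, hΦ', ?_⟩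
  · rw [B.creationMonomials_eq, F.creationMonomials_eq]
    rintro _ ⟨p, hp, rfl⟩
    exact ⟨_, pairwise_blockModes hp 0, (hΦ p hp).symm⟩
  · rw [B.creationMonomials_eq]
    rintro _ ⟨p, hp, rfl⟩ _ ⟨p', hp', rfl⟩ h
    rw [hΦ p hp, hΦ p' hp'] at h
    rw [blockModes_injOn 0 hp hp' (F.prod_cre_injOn (pairwise_blockModes hp 0)
      (pairwise_blockModes hp' 0) h)]
  · rw [B.creationMonomials_eq, F.creationMonomials_eq]
    rintro _ ⟨l, hl, rfl⟩
    obtain ⟨p, hp, rfl⟩ := exists_blockModes_eq hl 0 (by simp)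
    exact ⟨_, ⟨p, hp, rfl⟩, hΦ p hp⟩
  · rintro VB VF hVB hVF U rfl
    rw [R.isBoseUnitary_iff] at hVB
    rw [R.isFermiUnitary_iff] at hVF
    have hVB' : ∀ l, VB.symm (B.ladder.word l) = R.boseLadder.word l := fun l => by
      rw [← hVB, VB.symm_apply_apply]
    refine ⟨?_, fun m n k hn hk => ?_⟩
    · exact (congrArg VF (hVB' [])).trans (hVF [])
    · have hp := isOccupation_ofFn hn hk
      have hfac : ∏ i, ((k i).factorial : ℝ) =
          occupationFactor (List.ofFn fun i => (n i, k i)) := by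
        rw [occupationFactor, List.map_ofFn, List.prod_ofFn]
        rfl
      -- Both sides are images of one vector of `H`, written as a boson word and as a multiple of a
      -- fermion word.
      rw [hΦ' m n k hn hk, F.blocks_eq, F.prod_cre_vac, B.monomial_eq, B.occupationMonomial_vac,
        LinearIsometryEquiv.trans_apply, hVB', R.word_bosonModes hp, map_smul, hVF, hfac]
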